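/- Let $M$ be a complex manifold, let $D\subset TM$ be a holomorphic distribution, i.e. a holomorphic vector subbundle of constant rank of the tangent bundle, and let $D^\perp\subset T^\vee M$ be the bundle of cotangent vectors annihilating $D$. Let $\mathrm{Levi}^D_x:\wedge^2D_x\to T_xM/D_x$ be the Levi tensor, $\mathrm{Levi}^D_x(\vec u(x),\vec v(x))=[\vec u,\vec v](x)\bmod D_x$ for local holomorphic sections $\vec u,\vec v$ of $D$ near $x$. For $\alpha\in D^\perp_x=(T_xM/D_x)^\vee$ put $$\mathrm{Null}(\alpha\circ\mathrm{Levi}^D_x)=\{v\in D_x:\ \alpha(\mathrm{Levi}^D_x(v,u))=0\ \text{ for all } u\in D_x\}.$$ Let $\mathbb P D^\perp\subset\mathbb P T^\vee M$ be the complex manifolds of one-dimensional subspaces of the fibers of $D^\perp$ and $T^\vee M$, with projections $\varpi_D:\mathbb P D^\perp\to M$ and $\varpi:\mathbb P T^\vee M\to M$, and let $\mathcal O(1)$ be the line bundle with fiber $\mathrm{Hom}(\mathbb C\alpha,\mathbb C)$ at $[\alpha]$. Let $\vartheta^M$ be the $\mathcal O(1)$-valued 1-form on $\mathbb P T^\vee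 M$ given by $\vartheta^M(u)=\alpha(\mathrm d\varpi(u))\cdot\alpha^\vee$ for $u\in T_{[\alpha]}(\mathbb P T^\vee M)$, where $\alpha^\vee\in\mathrm{Hom}(\mathbb C\alpha,\mathbb C)$ satisfies $\alpha^\vee(\alpha)=1$, and let $\vartheta=\vartheta^M|_{\mathbb P D^\perp}$ be its restriction (pull-back) to $\mathbb P D^\perp$. The twisted differential $\mathrm d_p\vartheta:\wedge^2\mathrm{Ker}(\vartheta_p)\to\mathcal O(1)_p$ at $p\in\mathbb P D^\perp$ is defined by $\mathrm d_p\vartheta(u,v)=\mathrm d\check\vartheta(u,v)\cdot l_p$, where $l$ is a holomorphic section of $\mathcal O(1)$ near $p$ with $l_p\neq0$ and $\vartheta=\check\vartheta\otimes l$ near $p$ for a 1-form $\check\vartheta$ (this does not depend on the choice of $l$); put $$\mathrm{Null}(\mathrm d_p\vartheta)=\{v\in\mathrm{Ker}(\vartheta_p):\ \mathrm d_p\vartheta(u,v)=0\ \text{ for all } u\in\mathrm{Ker}(\vartheta_p)\}.$$ Then for every $x\in M$ and every nonzero $\alpha\in D^\perp_x$, the differential $\mathrm d_{[\alpha]}\varpi_D:T_{[\alpha]}(\mathbb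 P D^\perp)\to T_xM$ of the natural projection restricts to a linear isomorphism $$\mathrm{Null}\big(\mathrm d_{[\alpha]}(\vartheta^M|_{\mathbb P D^\perp})\big)\ \cong\ \mathrm{Null}(\alpha\circ\mathrm{Levi}^D_x)\subset D_x .$$ -/

import Mathlib

set_option linter.unusedSectionVars false

open scoped Manifold ContDiff Bundle Topology LinearAlgebra.Projectivization

/-- `W` is a vector field on `M` which is holomorphic at every point of `U`. -/
def HolVectorFieldOn {E : Type*} [NormedAddCommGroup E] [NormedSpace ℂ E]
    {M : Type*} [TopologicalSpace M] [ChartedSpace E M] [IsManifold 𝓘(ℂ, E) ω M]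
    (W : ∀ y : M, TangentSpace 𝓘(ℂ, E) y) (U : Set M) : Prop :=
  ContMDiffOn 𝓘(ℂ, E) (𝓘(ℂ, E).prod 𝓘(ℂ, E)) ω (fun y => Bundle.TotalSpace.mk' E y (W y)) U

section Coeff
variable {E : Type*} [NormedAddCommGroup E] [NormedSpace ℂ E] [FiniteDimensional ℂ E]
    {M : Type*} [TopologicalSpace M] [ChartedSpace E M] [IsManifold 𝓘(ℂ, E) ω M]

theorem contMDiffAt_coeff_of_eventually_eq_sum {ι : Type*} [Fintype ι]
    {s : ι → ∀ y : M, TangentSpace 𝓘(ℂ, E) y}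
    {V : ∀ y : M, TangentSpace 𝓘(ℂ, E) y} {f : ι → M → ℂ} {x : M}
    (hs : ∀ i, ContMDiffAt 𝓘(ℂ, E) (𝓘(ℂ, E).prod 𝓘(ℂ, E)) ω
      (fun y => Bundle.TotalSpace.mk' E y (s i y)) x)
    (hV : ContMDiffAt 𝓘(ℂ, E) (𝓘(ℂ, E).prod 𝓘(ℂ, E)) ω
      (fun y => Bundle.TotalSpace.mk' E y (V y)) x)
    (hli : LinearIndependent ℂ (fun i => s i x))
    (h : ∀ᶠ y in 𝓝 x, V y = ∑ i, f i y • s i y) :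
    ContMDiffAt 𝓘(ℂ, E) 𝓘(ℂ, ι → ℂ) ω (fun y i => f i y) x := by
  classical
  set t := trivializationAt E (TangentSpace 𝓘(ℂ, E) : M → Type _) x with ht
  have hxt : x ∈ t.baseSet := FiberBundle.mem_baseSet_trivializationAt' x
  have hs' : ∀ i, ContMDiffAt 𝓘(ℂ, E) 𝓘(ℂ, E) ω (fun y => (t ⟨y, s i y⟩).2) x :=
    fun i => (t.contMDiffAt_section_iff hxt).1 (hs i)
  have hV' : ContMDiffAt 𝓘(ℂ, E) 𝓘(ℂ, E) ω (fun y => (t ⟨y, V y⟩).2) x :=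
    (t.contMDiffAt_section_iff hxt).1 hV
  -- the frame as a family of linear maps to the model fibre
  let L : M → ((ι → ℂ) →L[ℂ] E) := fun y =>
    ∑ i, (ContinuousLinearMap.smulRightL ℂ (ι → ℂ) E (ContinuousLinearMap.proj i)) (t ⟨y, s i y⟩).2
  have hL : ContMDiffAt 𝓘(ℂ, E) 𝓘(ℂ, (ι → ℂ) →L[ℂ] E) ω L x := by
    apply ContMDiffAt.sum
    intro i _
    exact (ContinuousLinearMap.smulRightL ℂ (ι → ℂ) E
      (ContinuousLinearMap.proj i)).contDiff.contDiffAt.contMDiffAt.comp x (hs' i)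
  have hLapp : ∀ y ∈ t.baseSet, ∀ a : ι → ℂ, L y a = (t ⟨y, ∑ i, a i • s i y⟩).2 := by
    intro y hy a
    have := map_sum (t.linearMapAt ℂ y) (fun i => a i • s i y) Finset.univ
    simp only [map_smul] at this
    simp only [t.coe_linearMapAt_of_mem (R := ℂ) hy] at this
    rw [this]
    simp [L]
  have hinj : Function.Injective (L x) := by
    rw [injective_iff_map_eq_zero]
    intro a ha
    rw [hLapp x hxt] at ha
    have h0 : t.linearMapAt ℂ x (∑ i, a i • s i x) = 0 := by
      rw [t.coe_linearMapAt_of_mem (R := ℂ) hxt]; exact ha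
    have h1 : ∑ i, a i • s i x = 0 := by
      apply (t.linearEquivAt ℂ x hxt).injective
      rw [map_zero, ← h0]
      simp [t.coe_linearMapAt_of_mem (R := ℂ) hxt]
    exact funext (Fintype.linearIndependent_iff.1 hli a h1)
  obtain ⟨P0, hP0⟩ := (L x).toLinearMap.exists_leftInverse_of_injective
    (LinearMap.ker_eq_bot.2 hinj)
  let P : E →L[ℂ] (ι → ℂ) := LinearMap.toContinuousLinearMap P0
  let G : M → ((ι → ℂ) →L[ℂ] (ι → ℂ)) := fun y => P.comp (L y)
  have hGx : G x = 1 := by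
    ext1 a
    exact LinearMap.congr_fun hP0 a
  have hG : ContMDiffAt 𝓘(ℂ, E) 𝓘(ℂ, (ι → ℂ) →L[ℂ] (ι → ℂ)) ω G x :=
    (ContinuousLinearMap.compL ℂ (ι → ℂ) E (ι → ℂ) P).contDiff.contDiffAt.contMDiffAt.comp x hL
  have hu : ∀ᶠ y in 𝓝 x, IsUnit (G y) :=
    hG.continuousAt.eventually (Units.isOpen.mem_nhds (by
      show IsUnit (G x); rw [hGx]; exact isUnit_one))
  have hinv : ContMDiffAt 𝓘(ℂ, E) 𝓘(ℂ, (ι → ℂ) →L[ℂ] (ι → ℂ)) ω (fun y => Ring.inverse (G y)) x := by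
    have h1 : ContDiffAt ℂ ω (Ring.inverse : ((ι → ℂ) →L[ℂ] (ι → ℂ)) → _) (G x) := by
      rw [hGx]; exact contDiffAt_ringInverse ℂ (1 : ((ι → ℂ) →L[ℂ] (ι → ℂ))ˣ)
    exact h1.contMDiffAt.comp x hG
  have hPV : ContMDiffAt 𝓘(ℂ, E) 𝓘(ℂ, ι → ℂ) ω (fun y => P (t ⟨y, V y⟩).2) x :=
    P.contDiff.contDiffAt.contMDiffAt.comp x hV'
  have hfin := hinv.clm_apply hPV
  refine hfin.congr_of_eventuallyEq ?_
  filter_upwards [hu, h, t.open_baseSet.mem_nhds hxt] with y hy hVy hyt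
  have : P (t ⟨y, V y⟩).2 = G y (fun i => f i y) := by
    rw [hVy, ← hLapp y hyt]; rfl
  rw [this]
  have h2 := Ring.inverse_mul_cancel _ hy
  exact (DFunLike.congr_fun h2 (fun i => f i y)).symm

end Coeff

/-- A holomorphic distribution of rank `r` on the complex manifold `M`, i.e. a holomorphic vector
subbundle of rank `r` of the tangent bundle: a subspace of each tangent space, locally spanned
by `r` holomorphic vector fields which are pointwise linearly independent. -/
structure HolDistribution (E : Type*) [NormedAddCommGroup E] [NormedSpace ℂ E]
    (M : Type*) [TopologicalSpace M] [ChartedSpace E M] [IsManifold 𝓘(ℂ, E) ω M] (r : ℕ) where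
  fiber : ∀ x : M, Submodule ℂ (TangentSpace 𝓘(ℂ, E) x)
  exists_frame : ∀ x : M, ∃ (U : Set M) (s : Fin r → ∀ y : M, TangentSpace 𝓘(ℂ, E) y),
    IsOpen U ∧ x ∈ U ∧ (∀ i, HolVectorFieldOn (s i) U) ∧
      ∀ y ∈ U, LinearIndependent ℂ (fun i => s i y) ∧
        Submodule.span ℂ (Set.range fun i => s i y) = fiber y

namespace HolDistribution

variable {E : Type*} [NormedAddCommGroup E] [NormedSpace ℂ E]
    {M : Type*} [TopologicalSpace M] [ChartedSpace E M] [IsManifold 𝓘(ℂ, E) ω M] {r : ℕ}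

/-- The zero distribution. -/
noncomputable def zero (E : Type*) [NormedAddCommGroup E] [NormedSpace ℂ E]
    (M : Type*) [TopologicalSpace M] [ChartedSpace E M] [IsManifold 𝓘(ℂ, E) ω M] :
    HolDistribution E M 0 where
  fiber _ := ⊥
  exists_frame x := ⟨Set.univ, fun i => i.elim0, isOpen_univ, Set.mem_univ x, fun i => i.elim0,
    fun y _ => ⟨linearIndependent_empty_type, by simp⟩⟩

/-- The fibre at `x` of `D^⊥`: the cotangent vectors at `x` which annihilate `D_x`. -/
noncomputable def perp (D : HolDistribution E M r) (x : M) :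
    Submodule ℂ (Module.Dual ℂ (TangentSpace 𝓘(ℂ, E) x)) :=
  (D.fiber x).dualAnnihilator

/-- `V` is a holomorphic section of `D` in a neighborhood of `x`. -/
def IsLocalSection (D : HolDistribution E M r) (x : M)
    (V : ∀ y : M, TangentSpace 𝓘(ℂ, E) y) : Prop :=
  ∃ U : Set M, IsOpen U ∧ x ∈ U ∧ HolVectorFieldOn V U ∧ ∀ y ∈ U, V y ∈ D.fiber y

theorem IsLocalSection.contMDiffAt {D : HolDistribution E M r} {x : M}
    {V : ∀ y : M, TangentSpace 𝓘(ℂ, E) y} (h : D.IsLocalSection x V) :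
    ContMDiffAt 𝓘(ℂ, E) (𝓘(ℂ, E).prod 𝓘(ℂ, E)) ω (fun y => Bundle.TotalSpace.mk' E y (V y)) x := by
  obtain ⟨U, hU, hx, hV, -⟩ := h
  exact hV.contMDiffAt (hU.mem_nhds hx)

theorem IsLocalSection.mdifferentiableAt {D : HolDistribution E M r} {x : M}
    {V : ∀ y : M, TangentSpace 𝓘(ℂ, E) y} (h : D.IsLocalSection x V) :
    MDifferentiableAt 𝓘(ℂ, E) (𝓘(ℂ, E).prod 𝓘(ℂ, E))
      (fun y => Bundle.TotalSpace.mk' E y (V y)) x :=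
  h.contMDiffAt.mdifferentiableAt (by simp)

theorem IsLocalSection.mem {D : HolDistribution E M r} {x : M}
    {V : ∀ y : M, TangentSpace 𝓘(ℂ, E) y} (h : D.IsLocalSection x V) : V x ∈ D.fiber x := by
  obtain ⟨U, hU, hx, -, hV⟩ := h
  exact hV x hx

theorem IsLocalSection.add {D : HolDistribution E M r} {x : M}
    {V W : ∀ y : M, TangentSpace 𝓘(ℂ, E) y} (hV : D.IsLocalSection x V)
    (hW : D.IsLocalSection x W) : D.IsLocalSection x (V + W) := by
  obtain ⟨U, hU, hx, h1, h2⟩ := hV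
  obtain ⟨U', hU', hx', h1', h2'⟩ := hW
  exact ⟨U ∩ U', hU.inter hU', ⟨hx, hx'⟩, ContMDiffOn.add_section
    (ContMDiffOn.mono h1 Set.inter_subset_left)
    (ContMDiffOn.mono h1' Set.inter_subset_right),
    fun y hy => add_mem (h2 y hy.1) (h2' y hy.2)⟩

theorem IsLocalSection.const_smul {D : HolDistribution E M r} {x : M} (c : ℂ)
    {V : ∀ y : M, TangentSpace 𝓘(ℂ, E) y} (hV : D.IsLocalSection x V) :
    D.IsLocalSection x (c • V) := by
  obtain ⟨U, hU, hx, h1, h2⟩ := hV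
  exact ⟨U, hU, hx, ContMDiffOn.const_smul_section h1, fun y hy => Submodule.smul_mem _ _ (h2 y hy)⟩

/-- Every vector of `D_x` is the value at `x` of a local holomorphic section of `D`. -/
theorem exists_isLocalSection (D : HolDistribution E M r) (x : M) (u : D.fiber x) :
    ∃ V : ∀ y : M, TangentSpace 𝓘(ℂ, E) y, D.IsLocalSection x V ∧ V x = u := by
  obtain ⟨U, s, hU, hx, hs, hsp⟩ := D.exists_frame x
  have hu : (u : TangentSpace 𝓘(ℂ, E) x) ∈ Submodule.span ℂ (Set.range fun i => s i x) := by
    rw [(hsp x hx).2]; exact u.2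
  obtain ⟨c, hc⟩ := (Submodule.mem_span_range_iff_exists_fun ℂ).1 hu
  refine ⟨fun y => ∑ i, c i • s i y, ⟨U, hU, hx, ?_, ?_⟩, hc⟩
  · exact ContMDiffOn.sum_section fun i _ => ContMDiffOn.const_smul_section (hs i)
  · intro y hy
    rw [← (hsp y hy).2]
    exact Submodule.sum_mem _ fun i _ => Submodule.smul_mem _ _ (Submodule.subset_span ⟨i, rfl⟩)

/-- A local holomorphic section of `D` through the vector `u ∈ D_x`. -/
noncomputable def localSection (D : HolDistribution E M r) (x : M) (u : D.fiber x) :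
    ∀ y : M, TangentSpace 𝓘(ℂ, E) y :=
  (D.exists_isLocalSection x u).choose

theorem localSection_spec (D : HolDistribution E M r) (x : M) (u : D.fiber x) :
    D.IsLocalSection x (D.localSection x u) ∧ D.localSection x u x = u :=
  (D.exists_isLocalSection x u).choose_spec

variable [FiniteDimensional ℂ E]

/-- The bracket of a vector field with a local section of `D` vanishing at `x` lies in `D_x`. -/
theorem mlieBracket_mem_of_eq_zero (D : HolDistribution E M r) {x : M}
    {U V : ∀ y : M, TangentSpace 𝓘(ℂ, E) y} (hV : D.IsLocalSection x V) (h0 : V x = 0) :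
    VectorField.mlieBracket 𝓘(ℂ, E) U V x ∈ D.fiber x := by
  classical
  obtain ⟨O, s, hO, hx, hs, hsp⟩ := D.exists_frame x
  obtain ⟨O', hO', hx', hVs, hVm⟩ := hV
  have hex : ∀ y, ∃ c : Fin r → ℂ, y ∈ O ∩ O' → ∑ i, c i • s i y = V y := by
    intro y
    by_cases hy : y ∈ O ∩ O'
    · have hu : V y ∈ Submodule.span ℂ (Set.range fun i => s i y) := by
        rw [(hsp y hy.1).2]; exact hVm y hy.2
      obtain ⟨c, hc⟩ := (Submodule.mem_span_range_iff_exists_fun ℂ).1 hu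
      exact ⟨c, fun _ => hc⟩
    · exact ⟨0, fun h => absurd h hy⟩
  choose c hc using hex
  have hev : ∀ᶠ y in 𝓝 x, V y = ∑ i, c y i • s i y := by
    filter_upwards [(hO.inter hO').mem_nhds ⟨hx, hx'⟩] with y hy using (hc y hy).symm
  have hsx : ∀ i, ContMDiffAt 𝓘(ℂ, E) (𝓘(ℂ, E).prod 𝓘(ℂ, E)) ω
      (fun y => Bundle.TotalSpace.mk' E y (s i y)) x :=
    fun i => ContMDiffOn.contMDiffAt (hs i) (hO.mem_nhds hx)
  have hcs := contMDiffAt_coeff_of_eventually_eq_sum (f := fun i y => c y i) hsx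
    (ContMDiffOn.contMDiffAt hVs (hO'.mem_nhds hx')) (hsp x hx).1 hev
  have hcd : ∀ i, MDifferentiableAt 𝓘(ℂ, E) 𝓘(ℂ, ℂ) (fun y => c y i) x := by
    intro i
    exact ((contMDiffAt_pi_space.1 hcs) i).mdifferentiableAt (by simp)
  have hsd : ∀ i, MDifferentiableAt 𝓘(ℂ, E) (𝓘(ℂ, E).prod 𝓘(ℂ, E))
      (fun y => Bundle.TotalSpace.mk' E y (s i y)) x := fun i => (hsx i).mdifferentiableAt (by simp)
  have hcx : ∀ i, c x i = 0 := by
    refine Fintype.linearIndependent_iff.1 (hsp x hx).1 (c x) ?_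
    rw [hc x ⟨hx, hx'⟩, h0]
  have hev' : V =ᶠ[𝓝 x] ∑ i, (fun y => c y i) • s i := by
    filter_upwards [hev] with y hy
    rw [hy]
    exact (Finset.sum_apply y Finset.univ (fun i => (fun y => c y i) • s i)).symm
  rw [(Filter.EventuallyEq.refl _ U).mlieBracket_vectorField_eq hev']
  have key : ∀ S : Finset (Fin r),
      MDifferentiableAt 𝓘(ℂ, E) (𝓘(ℂ, E).prod 𝓘(ℂ, E))
        (fun y => Bundle.TotalSpace.mk' E y ((∑ i ∈ S, (fun y => c y i) • s i) y)) x ∧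
      VectorField.mlieBracket 𝓘(ℂ, E) U (∑ i ∈ S, (fun y => c y i) • s i) x ∈ D.fiber x := by
    intro S
    induction S using Finset.induction_on with
    | empty =>
      refine ⟨?_, by simp⟩
      rw [Finset.sum_empty]
      exact Bundle.mdifferentiable_zeroSection ℂ (TangentSpace 𝓘(ℂ, E) : M → Type _) x
    | insert a S ha ih =>
      have hda := (hcd a).smul_section (hsd a)
      rw [Finset.sum_insert ha]
      refine ⟨mdifferentiableAt_add_section hda ih.1, ?_⟩
      rw [VectorField.mlieBracket_add_right hda ih.1]
      refine add_mem ?_ ih.2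
      rw [VectorField.mlieBracket_smul_right (hcd a) (hsd a), hcx a, zero_smul, add_zero]
      refine Submodule.smul_mem _ _ ?_
      rw [← (hsp x hx).2]
      exact Submodule.subset_span ⟨a, rfl⟩
  exact (key Finset.univ).2

/-- Modulo `D_x`, the bracket at `x` of local sections of `D` depends only on their values
at `x`. -/
theorem mk_mlieBracket_congr (D : HolDistribution E M r) {x : M}
    {U V U' V' : ∀ y : M, TangentSpace 𝓘(ℂ, E) y} (hU : D.IsLocalSection x U)
    (hV : D.IsLocalSection x V) (hU' : D.IsLocalSection x U') (hV' : D.IsLocalSection x V')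
    (h1 : U x = U' x) (h2 : V x = V' x) :
    (D.fiber x).mkQ (VectorField.mlieBracket 𝓘(ℂ, E) U V x) =
      (D.fiber x).mkQ (VectorField.mlieBracket 𝓘(ℂ, E) U' V' x) := by
  have aux : ∀ (U : ∀ y : M, TangentSpace 𝓘(ℂ, E) y) {V V' : ∀ y : M, TangentSpace 𝓘(ℂ, E) y},
      D.IsLocalSection x V → D.IsLocalSection x V' → V x = V' x →
      VectorField.mlieBracket 𝓘(ℂ, E) U V x - VectorField.mlieBracket 𝓘(ℂ, E) U V' x
        ∈ D.fiber x := by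
    intro U V V' hV hV' h
    have h3 := D.mlieBracket_mem_of_eq_zero (U := U) (hV.add (hV'.const_smul (-1))) (by simp [h])
    rw [VectorField.mlieBracket_add_right hV.mdifferentiableAt
      (hV'.const_smul (-1)).mdifferentiableAt,
      VectorField.mlieBracket_const_smul_right hV'.mdifferentiableAt] at h3
    simpa [sub_eq_add_neg] using h3
  have e1 := aux U hV hV' h2
  have e2 := aux V' hU hU' h1
  rw [VectorField.mlieBracket_swap_apply, VectorField.mlieBracket_swap_apply (V := V')] at e2
  rw [← sub_eq_zero, ← map_sub, Submodule.mkQ_apply, Submodule.Quotient.mk_eq_zero]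
  have := sub_mem e1 e2
  convert this using 1
  abel

/-- The Levi tensor `Levi^D_x : D_x × D_x → T_x M / D_x`: the class of the Lie bracket at `x` of
local sections of `D` through the two given vectors. -/
noncomputable def levi (D : HolDistribution E M r) (x : M) :
    D.fiber x →ₗ[ℂ] D.fiber x →ₗ[ℂ] (TangentSpace 𝓘(ℂ, E) x ⧸ D.fiber x) :=
  LinearMap.mk₂ ℂ
    (fun u v => (D.fiber x).mkQ
      (VectorField.mlieBracket 𝓘(ℂ, E) (D.localSection x u) (D.localSection x v) x))
    (by
      intro u u' v
      have hu := D.localSection_spec x u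
      have hu' := D.localSection_spec x u'
      have hv := D.localSection_spec x v
      have huu := D.localSection_spec x (u + u')
      rw [← map_add, ← VectorField.mlieBracket_add_left hu.1.mdifferentiableAt
        hu'.1.mdifferentiableAt]
      exact D.mk_mlieBracket_congr huu.1 hv.1 (hu.1.add hu'.1) hv.1
        (by simp [huu.2, hu.2, hu'.2]) rfl)
    (by
      intro c u v
      have hu := D.localSection_spec x u
      have hv := D.localSection_spec x v
      have huu := D.localSection_spec x (c • u)
      rw [← map_smul, ← VectorField.mlieBracket_const_smul_left hu.1.mdifferentiableAt]
      exact D.mk_mlieBracket_congr huu.1 hv.1 (hu.1.const_smul c) hv.1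
        (by simp [huu.2, hu.2]) rfl)
    (by
      intro v u u'
      have hu := D.localSection_spec x u
      have hu' := D.localSection_spec x u'
      have hv := D.localSection_spec x v
      have huu := D.localSection_spec x (u + u')
      rw [← map_add, ← VectorField.mlieBracket_add_right hu.1.mdifferentiableAt
        hu'.1.mdifferentiableAt]
      exact D.mk_mlieBracket_congr hv.1 huu.1 hv.1 (hu.1.add hu'.1) rfl
        (by simp [huu.2, hu.2, hu'.2]))
    (by
      intro c v u
      have hu := D.localSection_spec x u
      have hv := D.localSection_spec x v
      have huu := D.localSection_spec x (c • u)
      rw [← map_smul, ← VectorField.mlieBracket_const_smul_right hu.1.mdifferentiableAt]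
      exact D.mk_mlieBracket_congr hv.1 huu.1 hv.1 (hu.1.const_smul c) rfl
        (by simp [huu.2, hu.2]))

/-- The Levi tensor may be computed from any local sections of `D`. -/
theorem levi_apply (D : HolDistribution E M r) (x : M) {U V : ∀ y : M, TangentSpace 𝓘(ℂ, E) y}
    (hU : D.IsLocalSection x U) (hV : D.IsLocalSection x V) :
    D.levi x ⟨U x, hU.mem⟩ ⟨V x, hV.mem⟩ =
      (D.fiber x).mkQ (VectorField.mlieBracket 𝓘(ℂ, E) U V x) :=
  D.mk_mlieBracket_congr (D.localSection_spec x _).1 (D.localSection_spec x _).1 hU hV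
    (D.localSection_spec x _).2 (D.localSection_spec x _).2

/-- The form `α ∘ Levi^D_x` on `D_x`, where `α ∈ D^⊥_x` is regarded as a linear form on
`T_x M / D_x`. -/
noncomputable def perpLevi (D : HolDistribution E M r) (x : M) (α : D.perp x) :
    D.fiber x →ₗ[ℂ] D.fiber x →ₗ[ℂ] ℂ :=
  (D.levi x).compr₂ ((D.fiber x).liftQ (α : Module.Dual ℂ (TangentSpace 𝓘(ℂ, E) x))
    (fun v hv => (Submodule.mem_dualAnnihilator _).1 α.2 v hv))

/-- `Null(α ∘ Levi^D_x) = {v ∈ D_x : (α ∘ Levi^D_x)(v, u) = 0 for all u ∈ D_x}`. -/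
def nullPerpLevi (D : HolDistribution E M r) (x : M) (α : D.perp x) :
    Submodule ℂ (D.fiber x) where
  carrier := {v | ∀ u : D.fiber x, D.perpLevi x α v u = 0}
  add_mem' := by intro a b ha hb u; simp [ha u, hb u]
  zero_mem' := by intro u; simp
  smul_mem' := by intro c a ha u; simp [ha u]


/-! ### The projectivization `ℙ D^⊥` as a complex manifold -/

/-- The points of the projectivization `ℙ D^⊥ ⊂ ℙ T^∨ M`: a point `base` of `M` together with a
one-dimensional subspace `line` of `T^∨_base M` which is contained in `D^⊥_base`. -/
structure ProjPerp (D : HolDistribution E M r) where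
  base : M
  line : ℙ ℂ (Module.Dual ℂ (TangentSpace 𝓘(ℂ, E) base))
  le : line.submodule ≤ D.perp base

/-- The point `[α] ∈ ℙ D^⊥` of a nonzero covector `α ∈ D^⊥_x`. -/
noncomputable def projPoint (D : HolDistribution E M r) {x : M} (α : D.perp x) (hα : α ≠ 0) : D.ProjPerp where
  base := x
  line := Projectivization.mk ℂ (α : Module.Dual ℂ (TangentSpace 𝓘(ℂ, E) x))
    (fun h => hα (Subtype.ext h))
  le := by simp

/-- The dimension of the fibres of `ℙ D^⊥ → M`. (If `D = TM`, then `ℙ D^⊥` is empty and the value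
is irrelevant.) -/
noncomputable abbrev projDim (E : Type*) [NormedAddCommGroup E] [NormedSpace ℂ E] (r : ℕ) : ℕ :=
  Module.finrank ℂ E - r - 1

/-- The model space of the manifold `ℙ D^⊥`. -/
abbrev ProjModel (E : Type*) [NormedAddCommGroup E] [NormedSpace ℂ E] (r : ℕ) : Type _ :=
  E × (Fin (projDim E r) → ℂ)

/-- Data defining a chart of `ℙ D^⊥`: a chart of `M` and, on a nonempty open subset `dom` of its
domain, a holomorphic frame `s_1, ..., s_r, t_0, t_1, ..., t_k` of `TM` such that
`s_1, ..., s_r` is a frame of `D`. Here `s_i = vec (inl i)`, `t_0 = vec (inr none)` and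
`t_j = vec (inr (some j))`. -/
structure AdaptedFrame (D : HolDistribution E M r) where
  chart : OpenPartialHomeomorph M E
  chart_mem : chart ∈ atlas E M
  dom : Set M
  isOpen_dom : IsOpen dom
  dom_subset : dom ⊆ chart.source
  nonempty_dom : dom.Nonempty
  vec : Fin r ⊕ Option (Fin (projDim E r)) → ∀ y : M, TangentSpace 𝓘(ℂ, E) y
  frame : IsLocalFrameOn 𝓘(ℂ, E) E ω vec dom
  span_eq : ∀ y ∈ dom, Submodule.span ℂ (Set.range fun i => vec (Sum.inl i) y) = D.fiber y

namespace AdaptedFrame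

variable {D : HolDistribution E M r} (F F' : D.AdaptedFrame)

/-- The covector at `y` vanishing on `D_y`, with value `1` on `t_0` and value `a_j` on `t_j`. -/
noncomputable def form (y : M) (a : Fin (projDim E r) → ℂ) :
    Module.Dual ℂ (TangentSpace 𝓘(ℂ, E) y) :=
  F.frame.coeff (Sum.inr none) y + ∑ j, a j • F.frame.coeff (Sum.inr (some j)) y

theorem coeff_vec {y : M} (hy : y ∈ F.dom) (i j) :
    F.frame.coeff i y (F.vec j y) = if j = i then 1 else 0 := by
  classical
  rw [F.frame.coeff_apply_of_mem hy (F.vec j), ← F.frame.toBasisAt_coe hy j, Module.Basis.repr_self,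
    Finsupp.single_apply]

theorem form_inl {y : M} (hy : y ∈ F.dom) (a) (i) : F.form y a (F.vec (Sum.inl i) y) = 0 := by
  simp [form, F.coeff_vec hy]

theorem form_none {y : M} (hy : y ∈ F.dom) (a) : F.form y a (F.vec (Sum.inr none) y) = 1 := by
  simp [form, F.coeff_vec hy]

theorem form_some {y : M} (hy : y ∈ F.dom) (a) (j) :
    F.form y a (F.vec (Sum.inr (some j)) y) = a j := by
  simp [form, F.coeff_vec hy]

theorem form_mem {y : M} (hy : y ∈ F.dom) (a) : F.form y a ∈ D.perp y := by
  rw [perp, Submodule.mem_dualAnnihilator]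
  intro w hw
  rw [← F.span_eq y hy] at hw
  have : Submodule.span ℂ (Set.range fun i => F.vec (Sum.inl i) y) ≤ LinearMap.ker (F.form y a) := by
    rw [Submodule.span_le]
    rintro _ ⟨i, rfl⟩
    exact F.form_inl hy a i
  exact this hw

theorem form_ne_zero {y : M} (hy : y ∈ F.dom) (a) : F.form y a ≠ 0 := by
  intro h
  have := F.form_none hy a
  rw [h] at this
  simp at this

theorem vec_mem {y : M} (hy : y ∈ F.dom) (i) : F.vec (Sum.inl i) y ∈ D.fiber y := by
  rw [← F.span_eq y hy]; exact Submodule.subset_span ⟨i, rfl⟩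

theorem eq_form {y : M} (hy : y ∈ F.dom) {α : Module.Dual ℂ (TangentSpace 𝓘(ℂ, E) y)}
    (hα : α ∈ D.perp y) (h0 : α (F.vec (Sum.inr none) y) ≠ 0) :
    F.form y (fun j => α (F.vec (Sum.inr (some j)) y) / α (F.vec (Sum.inr none) y)) =
      (α (F.vec (Sum.inr none) y))⁻¹ • α := by
  apply (F.frame.toBasisAt hy).ext
  intro i
  rw [F.frame.toBasisAt_coe hy]
  rcases i with i | _ | j
  · rw [F.form_inl hy, LinearMap.smul_apply,
      (Submodule.mem_dualAnnihilator _).1 hα _ (F.vec_mem hy i), smul_zero]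
  · rw [F.form_none hy, LinearMap.smul_apply, smul_eq_mul, inv_mul_cancel₀ h0]
  · rw [F.form_some hy, LinearMap.smul_apply, smul_eq_mul, div_eq_inv_mul]

/-- The point of `ℙ D^⊥` over `y` with affine coordinates `a`. -/
noncomputable def point (y : M) (hy : y ∈ F.dom) (a : Fin (projDim E r) → ℂ) : D.ProjPerp :=
  D.projPoint ⟨F.form y a, F.form_mem hy a⟩ (fun h => F.form_ne_zero hy a (congrArg Subtype.val h))

end AdaptedFrame

theorem ProjPerp.rep_mem {D : HolDistribution E M r} (p : D.ProjPerp) :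
    p.line.rep ∈ D.perp p.base := by
  apply p.le
  rw [Projectivization.submodule_eq]
  exact Submodule.mem_span_singleton_self _

theorem ProjPerp.exists_rep_projPoint {D : HolDistribution E M r} {x : M} (α : D.perp x)
    (hα : α ≠ 0) : ∃ c : ℂ, c ≠ 0 ∧
      (D.projPoint α hα).line.rep = c • (α : Module.Dual ℂ (TangentSpace 𝓘(ℂ, E) x)) := by
  obtain ⟨c, hc⟩ := Projectivization.exists_smul_eq_mk_rep ℂ
    (α : Module.Dual ℂ (TangentSpace 𝓘(ℂ, E) x)) (fun h => hα (Subtype.ext h))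
  exact ⟨c, c.ne_zero, hc.symm⟩

namespace AdaptedFrame

variable {D : HolDistribution E M r} (F F' : D.AdaptedFrame)

theorem point_eq {p : D.ProjPerp} {y : M} (hy : y ∈ F.dom) (h : y = p.base)
    (h0 : p.line.rep (F.vec (Sum.inr none) p.base) ≠ 0) :
    F.point y hy (fun j => p.line.rep (F.vec (Sum.inr (some j)) p.base) /
      p.line.rep (F.vec (Sum.inr none) p.base)) = p := by
  subst h
  have h1 := F.eq_form hy p.rep_mem h0
  have h2 : Projectivization.mk ℂ _ (F.form_ne_zero hy
      (fun j => p.line.rep (F.vec (Sum.inr (some j)) p.base) /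
        p.line.rep (F.vec (Sum.inr none) p.base))) = p.line := by
    conv_rhs => rw [← p.line.mk_rep]
    rw [Projectivization.mk_eq_mk_iff']
    exact ⟨_, h1.symm⟩
  rcases p with ⟨x, l, hl⟩
  exact congrArg (fun l' : { l' : ℙ ℂ (Module.Dual ℂ (TangentSpace 𝓘(ℂ, E) x)) //
    l'.submodule ≤ D.perp x } => (⟨x, l'.1, l'.2⟩ : D.ProjPerp))
    (Subtype.ext h2 : (⟨_, (F.point x hy _).le⟩ : { l' : ℙ ℂ (Module.Dual ℂ
      (TangentSpace 𝓘(ℂ, E) x)) // l'.submodule ≤ D.perp x }) = ⟨l, hl⟩)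

theorem exists_rep_point {y : M} (hy : y ∈ F.dom) (a) :
    ∃ c : ℂ, c ≠ 0 ∧ ∀ w : TangentSpace 𝓘(ℂ, E) y,
      (show Module.Dual ℂ (TangentSpace 𝓘(ℂ, E) y) from (F.point y hy a).line.rep) w =
        c * F.form y a w := by
  obtain ⟨c, hc, h⟩ := ProjPerp.exists_rep_projPoint
      (⟨F.form _ a, F.form_mem hy a⟩ : D.perp y)
      (fun h => F.form_ne_zero hy a (congrArg Subtype.val h))
  exact ⟨c, hc, fun w => LinearMap.congr_fun h w⟩

open Classical in
/-- The chart of `ℙ D^⊥` associated with an adapted frame. It is defined at the points `[α]` over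
`dom` with `α(t_0) ≠ 0`, and sends `[α]` over `y` to the coordinates of `y` together with
`(α(t_1) / α(t_0), ..., α(t_k) / α(t_0))`. -/
noncomputable def projChart : PartialEquiv D.ProjPerp (ProjModel E r) where
  toFun p := (F.chart p.base, fun j =>
    p.line.rep (F.vec (Sum.inr (some j)) p.base) / p.line.rep (F.vec (Sum.inr none) p.base))
  invFun z := if h : F.chart.symm z.1 ∈ F.dom then F.point _ h z.2
    else F.point _ F.nonempty_dom.some_mem 0
  source := {p | p.base ∈ F.dom ∧ p.line.rep (F.vec (Sum.inr none) p.base) ≠ 0}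
  target := {z | z.1 ∈ F.chart.target ∧ F.chart.symm z.1 ∈ F.dom}
  map_source' := by
    rintro p ⟨hp, h0⟩
    refine ⟨F.chart.map_source (F.dom_subset hp), ?_⟩
    simpa [F.chart.left_inv (F.dom_subset hp)] using hp
  map_target' := by
    rintro z ⟨hz, hz'⟩
    rw [dif_pos hz']
    refine ⟨hz', ?_⟩
    obtain ⟨c, hc, h⟩ := F.exists_rep_point hz' z.2
    intro h'
    have h2 := (h (F.vec (Sum.inr none) _)).symm.trans h'
    rw [F.form_none hz'] at h2
    simp [hc] at h2
  left_inv' := by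
    rintro p ⟨hp, h0⟩
    have he : F.chart.symm (F.chart p.base) = p.base := F.chart.left_inv (F.dom_subset hp)
    have hd : F.chart.symm (F.chart p.base) ∈ F.dom := by rw [he]; exact hp
    dsimp only
    rw [dif_pos hd]
    exact F.point_eq hd he h0
  right_inv' := by
    rintro z ⟨hz, hz'⟩
    obtain ⟨c, hc, h⟩ := F.exists_rep_point hz' z.2
    rw [dif_pos hz']
    refine Prod.ext (F.chart.right_inv hz) ?_
    funext j
    have h1 := h (F.vec (Sum.inr (some j)) _)
    have h2 := h (F.vec (Sum.inr none) _)
    rw [F.form_some hz'] at h1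
    rw [F.form_none hz'] at h2
    refine (congrArg₂ (· / ·) h1 h2).trans ?_
    field_simp

end AdaptedFrame

section ExistsFrame

theorem exists_vectors {V : Type*} [AddCommGroup V] [Module ℂ V] [FiniteDimensional ℂ V]
    {r : ℕ} {s : Fin r → V} (hs : LinearIndependent ℂ s) {α : Module.Dual ℂ V} (hα : α ≠ 0)
    (hαs : ∀ i, α (s i) = 0) :
    r + (Module.finrank ℂ V - r - 1) + 1 = Module.finrank ℂ V ∧
    ∃ v : Fin r ⊕ Option (Fin (Module.finrank ℂ V - r - 1)) → V,
      (∀ i, v (Sum.inl i) = s i) ∧ LinearIndependent ℂ v ∧ α (v (Sum.inr none)) ≠ 0 := by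
  classical
  obtain ⟨w, hw⟩ : ∃ w, α w ≠ 0 := by
    by_contra! h
    exact hα (LinearMap.ext h)
  let S : Submodule ℂ V := Submodule.span ℂ (Set.range s)
  have hSK : S ≤ LinearMap.ker α := by
    rw [Submodule.span_le]; rintro _ ⟨i, rfl⟩; exact hαs i
  have hS : Module.finrank ℂ S = r := by
    simpa using finrank_span_eq_card hs
  have hK : Module.finrank ℂ (LinearMap.ker α) + 1 = Module.finrank ℂ V :=
    Module.Dual.finrank_ker_add_one_of_ne_zero hα
  obtain ⟨C, hC⟩ := Submodule.exists_isCompl (S.comap (LinearMap.ker α).subtype)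
  have hSc : Module.finrank ℂ (S.comap (LinearMap.ker α).subtype) = r := by
    rw [← hS]
    exact (Submodule.comapSubtypeEquivOfLe hSK).finrank_eq
  have hdim := Submodule.finrank_add_eq_of_isCompl hC
  rw [hSc] at hdim
  have hCd : Module.finrank ℂ C = Module.finrank ℂ V - r - 1 := by omega
  let b := Module.finBasisOfFinrankEq ℂ C hCd
  refine ⟨by omega, Sum.elim s (fun o => o.elim w (fun j => ((b j : LinearMap.ker α) : V))),
    fun i => rfl, ?_, hw⟩
  rw [Fintype.linearIndependent_iff]
  intro g hg
  rw [Fintype.sum_sum_type, Fintype.sum_option] at hg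
  simp only [Sum.elim_inl, Sum.elim_inr, Option.elim_none, Option.elim_some] at hg
  have hb0 : ∀ j, α ((b j : LinearMap.ker α) : V) = 0 := fun j => (b j : LinearMap.ker α).2
  have h0 : g (Sum.inr none) = 0 := by
    have := congrArg α hg
    simpa [map_sum, hαs, hb0, hw] using this
  rw [h0, zero_smul, zero_add] at hg
  let c : C := ∑ j, g (Sum.inr (some j)) • b j
  have hc : ((c : LinearMap.ker α) : V) = ∑ j, g (Sum.inr (some j)) • ((b j : LinearMap.ker α) : V) := by
    simp [c]
  have hcS : (c : LinearMap.ker α) ∈ S.comap (LinearMap.ker α).subtype := by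
    rw [Submodule.mem_comap, Submodule.subtype_apply, hc, ← neg_eq_of_add_eq_zero_right hg]
    exact neg_mem (Submodule.sum_mem _ fun i _ => Submodule.smul_mem _ _
      (Submodule.subset_span ⟨i, rfl⟩))
  have hc0 : (c : LinearMap.ker α) = 0 := (Submodule.disjoint_def.1 hC.disjoint) _ hcS c.2
  have hcc : c = 0 := Subtype.ext hc0
  have hgj := Fintype.linearIndependent_iff.1 b.linearIndependent
    (fun j => g (Sum.inr (some j))) hcc
  rw [← hc, hc0, ZeroMemClass.coe_zero, add_zero] at hg
  have hgi := Fintype.linearIndependent_iff.1 hs (fun i => g (Sum.inl i)) hg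
  rintro (i | _ | j)
  · exact hgi i
  · exact h0
  · exact hgj j

end ExistsFrame

namespace AdaptedFrame

variable {D : HolDistribution E M r}

theorem exists_mem_source (p : D.ProjPerp) : ∃ F : D.AdaptedFrame, p ∈ F.projChart.source := by
  classical
  obtain ⟨U, s, hU, hxU, hs, hsp⟩ := D.exists_frame p.base
  set x := p.base with hx
  set t := trivializationAt E (TangentSpace 𝓘(ℂ, E) : M → Type _) x with ht
  have hxt : x ∈ t.baseSet := FiberBundle.mem_baseSet_trivializationAt' x
  have hαs : ∀ i, p.line.rep (s i x) = 0 := by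
    intro i
    refine (Submodule.mem_dualAnnihilator _).1 p.rep_mem _ ?_
    rw [← (hsp x hxU).2]; exact Submodule.subset_span ⟨i, rfl⟩
  have hfd : FiniteDimensional ℂ (TangentSpace 𝓘(ℂ, E) x) :=
    inferInstanceAs (FiniteDimensional ℂ E)
  obtain ⟨hcard, v, hv1, hv2, hv3⟩ :=
    exists_vectors (V := TangentSpace 𝓘(ℂ, E) x) (hsp x hxU).1 p.line.rep_nonzero hαs
  let vec : Fin r ⊕ Option (Fin (projDim E r)) → ∀ y : M, TangentSpace 𝓘(ℂ, E) y := fun i y =>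
    Sum.elim (fun i => s i y) (fun o => t.symm y (t ⟨x, v (Sum.inr o)⟩).2) i
  have hvecx : ∀ i, vec i x = v i := by
    rintro (i | o)
    · exact (hv1 i).symm
    · exact t.symm_apply_apply_mk hxt _
  have hvec : ∀ i, ContMDiffOn 𝓘(ℂ, E) (𝓘(ℂ, E).prod 𝓘(ℂ, E)) ω
      (fun y => Bundle.TotalSpace.mk' E y (vec i y)) (U ∩ t.baseSet) := by
    rintro (i | o)
    · exact ContMDiffOn.mono (hs i) Set.inter_subset_left
    · refine ContMDiffOn.mono ?_ Set.inter_subset_right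
      rw [t.contMDiffOn_section_baseSet_iff]
      refine (contMDiffOn_const (c := (t ⟨x, v (Sum.inr o)⟩).2)).congr ?_
      intro y hy
      have h := congrArg Prod.snd (t.apply_mk_symm hy (t ⟨x, v (Sum.inr o)⟩).2)
      exact h
  have hO : IsOpen (U ∩ t.baseSet) := hU.inter t.open_baseSet
  have hcont : ContinuousOn (fun y i => (t ⟨y, vec i y⟩).2) (U ∩ t.baseSet) := by
    rw [continuousOn_pi]
    intro i
    exact ((t.contMDiffOn_section_iff hO Set.inter_subset_right).1 (hvec i)).continuousOn
  have hopen := hcont.isOpen_inter_preimage hO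
    (isOpen_setOfPred_linearIndependent (𝕜 := ℂ) (E := E)
      (ι := Fin r ⊕ Option (Fin (projDim E r))))
  have hli : ∀ y ∈ t.baseSet, (LinearIndependent ℂ (fun i => (t ⟨y, vec i y⟩).2) ↔
      LinearIndependent ℂ (fun i => vec i y)) := by
    intro y hy
    exact LinearMap.linearIndependent_iff (t.linearEquivAt ℂ y hy).toLinearMap
      (LinearEquiv.ker _) (v := fun i => vec i y)
  refine ⟨{ chart := chartAt E x
            chart_mem := chart_mem_atlas E x
            dom := (U ∩ t.baseSet ∩ (fun y i => (t ⟨y, vec i y⟩).2) ⁻¹'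
              {f | LinearIndependent ℂ f}) ∩ (chartAt E x).source
            isOpen_dom := hopen.inter (chartAt E x).open_source
            dom_subset := Set.inter_subset_right
            nonempty_dom := ?_
            vec := vec
            frame := ⟨?_, ?_, ?_⟩
            span_eq := ?_ }, ?_, ?_⟩
  · refine ⟨x, ⟨⟨⟨hxU, hxt⟩, ?_⟩, mem_chart_source E x⟩⟩
    refine (hli x hxt).2 ?_
    simp_rw [hvecx]; exact hv2
  · rintro y ⟨⟨⟨hyU, hyt⟩, hy⟩, -⟩
    exact (hli y hyt).1 hy
  · rintro y ⟨⟨⟨hyU, hyt⟩, hy⟩, -⟩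
    have h1 := (hli y hyt).1 hy
    have hfd : FiniteDimensional ℂ (TangentSpace 𝓘(ℂ, E) y) :=
      inferInstanceAs (FiniteDimensional ℂ E)
    refine (h1.span_eq_top_of_card_eq_finrank' ?_).ge
    simp only [Fintype.card_sum, Fintype.card_fin, Fintype.card_option]
    exact hcard
  · intro i
    exact (hvec i).mono fun y hy => hy.1.1
  · rintro y ⟨⟨⟨hyU, hyt⟩, hy⟩, -⟩
    exact (hsp y hyU).2
  · refine ⟨⟨⟨hxU, hxt⟩, ?_⟩, mem_chart_source E x⟩
    refine (hli x hxt).2 ?_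
    simp_rw [hvecx]; exact hv2
  · have := hvecx (Sum.inr none)
    change p.line.rep (vec (Sum.inr none) x) ≠ 0
    rw [this]; exact hv3

variable (F F' : D.AdaptedFrame)

/-- The values of the normalized covectors on a holomorphic vector field are holomorphic in the
chart coordinates. -/
theorem contDiffOn_form {O : Set M} (hO : IsOpen O) {W : ∀ y : M, TangentSpace 𝓘(ℂ, E) y}
    (hW : HolVectorFieldOn W O) :
    ContDiffOn ℂ ω (fun z : ProjModel E r => F.form (F.chart.symm z.1) z.2 (W (F.chart.symm z.1)))
      {z | z.1 ∈ F.chart.target ∧ F.chart.symm z.1 ∈ F.dom ∩ O} := by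
  classical
  rintro z ⟨hz, hzd, hzO⟩
  apply ContDiffAt.contDiffWithinAt
  set x := F.chart.symm z.1 with hx
  have hco : ContMDiffAt 𝓘(ℂ, E) 𝓘(ℂ, Fin r ⊕ Option (Fin (projDim E r)) → ℂ) ω
      (fun y i => F.frame.coeff i y (W y)) x := by
    refine contMDiffAt_coeff_of_eventually_eq_sum (f := fun i y => F.frame.coeff i y (W y))
      (fun i => F.frame.contMDiffAt F.isOpen_dom hzd i) (ContMDiffOn.contMDiffAt hW (hO.mem_nhds hzO))
      (F.frame.linearIndependent hzd) ?_
    exact F.frame.eventually_eq_sum_coeff_smul W (F.isOpen_dom.mem_nhds hzd)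
  have hsymm : ContMDiffAt 𝓘(ℂ, E) 𝓘(ℂ, E) ω F.chart.symm z.1 :=
    (contMDiffOn_symm_of_mem_maximalAtlas
      (IsManifold.subset_maximalAtlas F.chart_mem)).contMDiffAt (F.chart.open_target.mem_nhds hz)
  have hc : ContDiffAt ℂ ω (fun w : E => fun i => F.frame.coeff i (F.chart.symm w)
      (W (F.chart.symm w))) z.1 := by
    rw [← contMDiffAt_iff_contDiffAt]
    exact ContMDiffAt.comp z.1 hco hsymm
  have hc' : ∀ i, ContDiffAt ℂ ω (fun z : ProjModel E r => F.frame.coeff i (F.chart.symm z.1)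
      (W (F.chart.symm z.1))) z := by
    intro i
    exact (contDiffAt_pi.1 hc i).comp z contDiffAt_fst
  have : (fun z : ProjModel E r => F.form (F.chart.symm z.1) z.2 (W (F.chart.symm z.1))) =
      fun z => F.frame.coeff (Sum.inr none) (F.chart.symm z.1) (W (F.chart.symm z.1)) +
        ∑ j, z.2 j * F.frame.coeff (Sum.inr (some j)) (F.chart.symm z.1) (W (F.chart.symm z.1)) := by
    funext z
    simp [form, LinearMap.sum_apply]
  rw [this]
  refine (hc' _).add (ContDiffAt.sum fun j _ => ContDiffAt.mul ?_ (hc' _))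
  exact (contDiffAt_pi.1 contDiffAt_snd j)

theorem isOpen_coord {O : Set M} (hO : IsOpen O) :
    IsOpen {z : ProjModel E r | z.1 ∈ F.chart.target ∧ F.chart.symm z.1 ∈ F.dom ∩ O} :=
  (F.chart.isOpen_inter_preimage_symm (F.isOpen_dom.inter hO)).preimage continuous_fst

theorem hol_vec (i) : HolVectorFieldOn (F.vec i) F.dom := F.frame.contMDiffOn i

theorem symm_apply {z : ProjModel E r} (hz : F.chart.symm z.1 ∈ F.dom) :
    F.projChart.symm z = F.point _ hz z.2 := dif_pos hz

theorem trans_source : (F.projChart.symm.trans F'.projChart).source =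
    {z | z.1 ∈ F.chart.target ∧ F.chart.symm z.1 ∈ F.dom ∩ F'.dom} ∩
      (fun z : ProjModel E r =>
        F.form (F.chart.symm z.1) z.2 (F'.vec (Sum.inr none) (F.chart.symm z.1))) ⁻¹' {0}ᶜ := by
  ext z
  rw [PartialEquiv.trans_source]
  constructor
  · rintro ⟨⟨hz1, hz2⟩, hz3⟩
    rw [Set.mem_preimage, F.symm_apply hz2] at hz3
    refine ⟨⟨hz1, hz2, hz3.1⟩, ?_⟩
    obtain ⟨c, hc, h⟩ := F.exists_rep_point hz2 z.2
    intro h0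
    exact hz3.2 ((h _).trans ((congrArg (c * ·) (Set.mem_singleton_iff.1 h0)).trans (mul_zero c)))
  · rintro ⟨⟨hz1, hz2, hz3⟩, hz4⟩
    refine ⟨⟨hz1, hz2⟩, ?_⟩
    rw [Set.mem_preimage, F.symm_apply hz2]
    refine ⟨hz3, ?_⟩
    obtain ⟨c, hc, h⟩ := F.exists_rep_point hz2 z.2
    intro h0
    exact mul_ne_zero hc hz4 ((h _).symm.trans h0)

theorem isOpen_trans_source : IsOpen (F.projChart.symm.trans F'.projChart).source := by
  rw [trans_source]
  exact (F.contDiffOn_form F'.isOpen_dom (F'.hol_vec _)).continuousOn.isOpen_inter_preimage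
    (F.isOpen_coord F'.isOpen_dom) isOpen_compl_singleton

theorem trans_apply {z : ProjModel E r}
    (hz : F.chart.symm z.1 ∈ F.dom) :
    (F.projChart.symm.trans F'.projChart) z = (F'.chart (F.chart.symm z.1), fun j =>
      F.form (F.chart.symm z.1) z.2 (F'.vec (Sum.inr (some j)) (F.chart.symm z.1)) /
      F.form (F.chart.symm z.1) z.2 (F'.vec (Sum.inr none) (F.chart.symm z.1))) := by
  rw [PartialEquiv.coe_trans, Function.comp_apply, F.symm_apply hz]
  refine Prod.ext rfl ?_
  funext j
  obtain ⟨c, hc, h⟩ := F.exists_rep_point hz z.2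
  refine (congrArg₂ (· / ·) (h (F'.vec (Sum.inr (some j)) _))
    (h (F'.vec (Sum.inr none) _))).trans ?_
  rw [mul_div_mul_left _ _ hc]

theorem contDiffOn_trans :
    ContDiffOn ℂ ω (F.projChart.symm.trans F'.projChart)
      (F.projChart.symm.trans F'.projChart).source := by
  have hsub := (F.trans_source F').le
  refine ContDiffOn.congr (f := fun z : ProjModel E r => (F'.chart (F.chart.symm z.1), fun j =>
      F.form (F.chart.symm z.1) z.2 (F'.vec (Sum.inr (some j)) (F.chart.symm z.1)) /
      F.form (F.chart.symm z.1) z.2 (F'.vec (Sum.inr none) (F.chart.symm z.1)))) ?_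
    (fun z hz => F.trans_apply F' (hsub hz).1.2.1)
  refine ContDiffOn.prodMk ?_ ?_
  · rintro z hz
    have hz' := (hsub hz).1
    apply ContDiffAt.contDiffWithinAt
    have hsymm : ContMDiffAt 𝓘(ℂ, E) 𝓘(ℂ, E) ω F.chart.symm z.1 :=
      (contMDiffOn_symm_of_mem_maximalAtlas
        (IsManifold.subset_maximalAtlas F.chart_mem)).contMDiffAt
          (F.chart.open_target.mem_nhds hz'.1)
    have hch : ContMDiffAt 𝓘(ℂ, E) 𝓘(ℂ, E) ω F'.chart (F.chart.symm z.1) :=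
      (contMDiffOn_of_mem_maximalAtlas
        (IsManifold.subset_maximalAtlas F'.chart_mem)).contMDiffAt
          (F'.chart.open_source.mem_nhds (F'.dom_subset hz'.2.2))
    have h := (hch.comp z.1 hsymm).contDiffAt
    exact h.comp z contDiffAt_fst
  · rw [contDiffOn_pi]
    intro j
    refine ContDiffOn.div ?_ ?_ ?_
    · exact (F.contDiffOn_form F'.isOpen_dom (F'.hol_vec _)).mono fun z hz => (hsub hz).1
    · exact (F.contDiffOn_form F'.isOpen_dom (F'.hol_vec _)).mono fun z hz => (hsub hz).1
    · intro z hz; exact (hsub hz).2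

end AdaptedFrame

/-- The charts of `ℙ D^⊥` attached to adapted frames are holomorphically compatible. -/
noncomputable def projCore (D : HolDistribution E M r) :
    ChartedSpaceCore (ProjModel E r) D.ProjPerp where
  atlas := Set.range fun F : D.AdaptedFrame => F.projChart
  chartAt p := (AdaptedFrame.exists_mem_source p).choose.projChart
  mem_chart_source p := (AdaptedFrame.exists_mem_source p).choose_spec
  chart_mem_atlas p := ⟨_, rfl⟩
  open_source := by
    rintro _ _ ⟨F, rfl⟩ ⟨F', rfl⟩
    exact F.isOpen_trans_source F'
  continuousOn_toFun := by
    rintro _ _ ⟨F, rfl⟩ ⟨F', rfl⟩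
    exact (F.contDiffOn_trans F').continuousOn

noncomputable instance (D : HolDistribution E M r) : TopologicalSpace D.ProjPerp :=
  D.projCore.toTopologicalSpace

noncomputable instance (D : HolDistribution E M r) : ChartedSpace (ProjModel E r) D.ProjPerp :=
  D.projCore.toChartedSpace

instance (D : HolDistribution E M r) : IsManifold 𝓘(ℂ, ProjModel E r) ω D.ProjPerp := by
  apply isManifold_of_contDiffOn
  intro e e' he he'
  change e ∈ ⋃ (e : PartialEquiv _ _) (he : e ∈ D.projCore.atlas), _ at he
  change e' ∈ ⋃ (e : PartialEquiv _ _) (he : e ∈ D.projCore.atlas), _ at he'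
  simp only [Set.mem_iUnion, Set.mem_singleton_iff] at he he'
  obtain ⟨_, ⟨F, rfl⟩, rfl⟩ := he
  obtain ⟨_, ⟨F', rfl⟩, rfl⟩ := he'
  have h := F.contDiffOn_trans F'
  simp only [modelWithCornersSelf_coe, modelWithCornersSelf_coe_symm, Set.preimage_id,
    Set.range_id, Set.inter_univ, Function.id_comp, Function.comp_id]
  exact h

/-- The natural projection `ℙ D^⊥ → M`. -/
def proj (D : HolDistribution E M r) (p : D.ProjPerp) : M := p.base

/-! ### The line bundle `O(1)` on `ℙ D^⊥` -/

/-- The fibre `O(1)_{[α]} = Hom(ℂα, ℂ)` of the line bundle `O(1)` on `ℙ D^⊥`. -/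
def O1 (D : HolDistribution E M r) (p : D.ProjPerp) : Type _ :=
  Module.Dual ℂ p.line.submodule

noncomputable instance (D : HolDistribution E M r) (p : D.ProjPerp) : AddCommGroup (D.O1 p) :=
  inferInstanceAs (AddCommGroup (Module.Dual ℂ p.line.submodule))

noncomputable instance (D : HolDistribution E M r) (p : D.ProjPerp) : Module ℂ (D.O1 p) :=
  inferInstanceAs (Module ℂ (Module.Dual ℂ p.line.submodule))

/-- The fibres of `O(1)` carry the canonical topology of a finite-dimensional vector space. -/
noncomputable instance (D : HolDistribution E M r) (p : D.ProjPerp) : TopologicalSpace (D.O1 p) :=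
  moduleTopology ℂ (D.O1 p)

instance (D : HolDistribution E M r) (p : D.ProjPerp) : IsModuleTopology ℂ (D.O1 p) := ⟨rfl⟩

/-- The element of `O(1)_{[α]} = Hom(ℂα, ℂ)` given by evaluating covectors on the tangent
vector `w`. -/
noncomputable def evalO1 (D : HolDistribution E M r) (p : D.ProjPerp) :
    TangentSpace 𝓘(ℂ, E) p.base →ₗ[ℂ] D.O1 p :=
  p.line.submodule.subtype.dualMap ∘ₗ Module.Dual.eval ℂ (TangentSpace 𝓘(ℂ, E) p.base)

namespace AdaptedFrame

variable {D : HolDistribution E M r} (F F' : D.AdaptedFrame)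

/-- The representative `α` of `[α]` with `α(t_0) = 1`. -/
noncomputable def normRep (p : D.ProjPerp) : p.line.submodule :=
  (p.line.rep (F.vec (Sum.inr none) p.base))⁻¹ • ⟨p.line.rep, by
    rw [Projectivization.submodule_eq]; exact Submodule.mem_span_singleton_self _⟩

theorem evalO1_normRep (p : D.ProjPerp) (w : TangentSpace 𝓘(ℂ, E) p.base) :
    (show Module.Dual ℂ p.line.submodule from D.evalO1 p w) (F.normRep p) =
      p.line.rep w / p.line.rep (F.vec (Sum.inr none) p.base) :=
  (div_eq_inv_mul _ _).symm

theorem O1_ext {p : D.ProjPerp} (hp : p ∈ F.projChart.source) {l l' : Module.Dual ℂ p.line.submodule}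
    (h : l (F.normRep p) = l' (F.normRep p)) : l = l' := by
  refine LinearMap.ext fun β => ?_
  obtain ⟨c, hc⟩ : ∃ c : ℂ, c • p.line.rep = (β : Module.Dual ℂ (TangentSpace 𝓘(ℂ, E) p.base)) := by
    exact Submodule.mem_span_singleton.1 (p.line.submodule_eq.le β.2)
  have hβ : β = (c * p.line.rep (F.vec (Sum.inr none) p.base)) • F.normRep p := by
    apply Subtype.ext
    rw [normRep, smul_smul, mul_assoc, mul_inv_cancel₀ hp.2, mul_one]
    exact hc.symm
  rw [hβ, map_smul, map_smul, h]

theorem smul_evalO1 {p : D.ProjPerp} (hp : p ∈ F.projChart.source) (l : D.O1 p) :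
    (show Module.Dual ℂ p.line.submodule from l) (F.normRep p) •
      D.evalO1 p (F.vec (Sum.inr none) p.base) = l := by
  refine F.O1_ext hp ?_
  have h := F.evalO1_normRep p (F.vec (Sum.inr none) p.base)
  rw [div_self hp.2] at h
  refine (congrArg ((show Module.Dual ℂ p.line.submodule from l) (F.normRep p) * ·) h).trans ?_
  exact mul_one _

/-- The local trivialization `l ↦ l(α)`, with `α` normalized by `α(t_0) = 1`, of `O(1)`. -/
noncomputable def trivO1 : Bundle.Pretrivialization ℂ (Bundle.TotalSpace.proj (F := ℂ) (E := D.O1)) where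
  toFun z := (z.1, (show Module.Dual ℂ z.1.line.submodule from z.2) (F.normRep z.1))
  invFun z := ⟨z.1, z.2 • D.evalO1 z.1 (F.vec (Sum.inr none) z.1.base)⟩
  source := Bundle.TotalSpace.proj ⁻¹' F.projChart.source
  target := F.projChart.source ×ˢ Set.univ
  map_source' z hz := ⟨hz, Set.mem_univ _⟩
  map_target' z hz := hz.1
  left_inv' := by
    rintro ⟨p, l⟩ hp
    exact congrArg (Bundle.TotalSpace.mk p) (F.smul_evalO1 hp l)
  right_inv' := by
    rintro ⟨p, c⟩ ⟨hp, -⟩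
    refine Prod.ext rfl ?_
    have h := F.evalO1_normRep p (F.vec (Sum.inr none) p.base)
    rw [div_self hp.2] at h
    refine (congrArg (c * ·) h).trans ?_
    exact mul_one _
  open_target := (D.projCore.open_source' ⟨F, rfl⟩).prod isOpen_univ
  baseSet := F.projChart.source
  open_baseSet := D.projCore.open_source' ⟨F, rfl⟩
  source_eq := rfl
  target_eq := rfl
  proj_toFun _ _ := rfl

instance : F.trivO1.IsLinear ℂ where
  linear _ _ := ⟨fun _ _ => rfl, fun _ _ => rfl⟩

theorem trivO1_coordChange (p : D.ProjPerp) (hp : p ∈ F.trivO1.baseSet ∩ F'.trivO1.baseSet)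
    (v : ℂ) :
    (F'.trivO1 ⟨p, F.trivO1.symm p v⟩).2 = (p.line.rep (F.vec (Sum.inr none) p.base) /
      p.line.rep (F'.vec (Sum.inr none) p.base)) • v := by
  have h1 : F.trivO1.symm p v = v • D.evalO1 p (F.vec (Sum.inr none) p.base) := by
    rw [Bundle.Pretrivialization.symm_apply F.trivO1 hp.1]
    rfl
  rw [h1]
  refine (congrArg (v * ·) (F'.evalO1_normRep p (F.vec (Sum.inr none) p.base))).trans ?_
  rw [smul_eq_mul, mul_comm]

theorem contMDiffOn_projChart : ContMDiffOn 𝓘(ℂ, ProjModel E r) 𝓘(ℂ, ProjModel E r) ω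
    F.projChart F.projChart.source := by
  have hmem : D.projCore.openPartialHomeomorph F.projChart ⟨F, rfl⟩ ∈
      atlas (ProjModel E r) D.ProjPerp := by
    change _ ∈ ⋃ (e : PartialEquiv _ _) (he : e ∈ D.projCore.atlas), _
    simp only [Set.mem_iUnion, Set.mem_singleton_iff]
    exact ⟨F.projChart, ⟨F, rfl⟩, rfl⟩
  exact contMDiffOn_of_mem_maximalAtlas (I := 𝓘(ℂ, ProjModel E r)) (n := ω)
    (IsManifold.subset_maximalAtlas hmem)

theorem contMDiffOn_ratio : ContMDiffOn 𝓘(ℂ, ProjModel E r) 𝓘(ℂ, ℂ) ω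
    (fun p : D.ProjPerp => p.line.rep (F.vec (Sum.inr none) p.base) /
      p.line.rep (F'.vec (Sum.inr none) p.base)) (F.projChart.source ∩ F'.projChart.source) := by
  have h1 := (F'.contDiffOn_form F.isOpen_dom (F.hol_vec (Sum.inr none))).contMDiffOn
  have h2 := F'.contMDiffOn_projChart.mono
    (Set.inter_subset_right : F.projChart.source ∩ F'.projChart.source ⊆ _)
  have hsub : F.projChart.source ∩ F'.projChart.source ⊆ F'.projChart ⁻¹'
      {z | z.1 ∈ F'.chart.target ∧ F'.chart.symm z.1 ∈ F'.dom ∩ F.dom} := by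
    rintro p ⟨hp, hp'⟩
    have he : F'.chart.symm (F'.chart p.base) = p.base := F'.chart.left_inv (F'.dom_subset hp'.1)
    refine ⟨F'.chart.map_source (F'.dom_subset hp'.1), ?_⟩
    change F'.chart.symm (F'.chart p.base) ∈ _
    rw [he]; exact ⟨hp'.1, hp.1⟩
  refine (h1.comp h2 hsub).congr ?_
  rintro p ⟨hp, hp'⟩
  have he : F'.chart.symm (F'.chart p.base) = p.base := F'.chart.left_inv (F'.dom_subset hp'.1)
  have key : ∀ y : M, y = p.base → F'.form y (F'.projChart p).2 (F.vec (Sum.inr none) y) =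
      p.line.rep (F.vec (Sum.inr none) p.base) / p.line.rep (F'.vec (Sum.inr none) p.base) := by
    rintro y rfl
    refine (LinearMap.congr_fun (F'.eq_form hp'.1 p.rep_mem hp'.2) _).trans ?_
    rw [LinearMap.smul_apply, smul_eq_mul, div_eq_inv_mul]
  exact (key _ he).symm

end AdaptedFrame

/-- The line bundle `O(1)` on `ℙ D^⊥`, given by its local trivializations. -/
noncomputable def preO1 (D : HolDistribution E M r) : VectorPrebundle ℂ ℂ D.O1 where
  pretrivializationAtlas := Set.range fun F : D.AdaptedFrame => F.trivO1
  pretrivialization_linear' := by rintro _ ⟨F, rfl⟩; infer_instance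
  pretrivializationAt p := (AdaptedFrame.exists_mem_source p).choose.trivO1
  mem_base_pretrivializationAt p := (AdaptedFrame.exists_mem_source p).choose_spec
  pretrivialization_mem_atlas p := ⟨_, rfl⟩
  exists_coordChange := by
    rintro _ ⟨F, rfl⟩ _ ⟨F', rfl⟩
    refine ⟨fun p => (p.line.rep (F.vec (Sum.inr none) p.base) /
      p.line.rep (F'.vec (Sum.inr none) p.base)) • ContinuousLinearMap.id ℂ ℂ, ?_, ?_⟩
    · exact (F.contMDiffOn_ratio F').continuousOn.smul continuousOn_const
    · intro p hp v
      rw [F.trivO1_coordChange F' p hp v]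
      rfl
  totalSpaceMk_isInducing := by
    intro p
    set F := (AdaptedFrame.exists_mem_source p).choose with hF
    have hp : p ∈ F.projChart.source := (AdaptedFrame.exists_mem_source p).choose_spec
    let f : D.O1 p →ₗ[ℂ] ℂ := Module.Dual.eval ℂ p.line.submodule (F.normRep p)
    let g : ℂ →ₗ[ℂ] D.O1 p := LinearMap.toSpanSingleton ℂ _ (D.evalO1 p (F.vec (Sum.inr none) p.base))
    have hgf : Function.LeftInverse g f := fun l => F.smul_evalO1 hp l
    have : ContinuousAdd (D.O1 p) := IsModuleTopology.toContinuousAdd ℂ (D.O1 p)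
    have hf : Topology.IsInducing f := by
      have hfc : Continuous f := IsModuleTopology.continuous_of_linearMap f
      have hgc : Continuous g := IsModuleTopology.continuous_of_linearMap g
      exact (Topology.IsEmbedding.of_leftInverse hgf hgc hfc).isInducing
    exact Topology.isInducing_const_prod.2 hf

noncomputable instance (D : HolDistribution E M r) :
    TopologicalSpace (Bundle.TotalSpace ℂ D.O1) := D.preO1.totalSpaceTopology

noncomputable instance (D : HolDistribution E M r) : FiberBundle ℂ D.O1 := D.preO1.toFiberBundle

instance (D : HolDistribution E M r) : VectorBundle ℂ ℂ D.O1 := D.preO1.toVectorBundle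

instance (D : HolDistribution E M r) :
    D.preO1.IsContMDiff 𝓘(ℂ, ProjModel E r) ω where
  exists_contMDiffCoordChange := by
    rintro _ ⟨F, rfl⟩ _ ⟨F', rfl⟩
    refine ⟨fun p => (p.line.rep (F.vec (Sum.inr none) p.base) /
      p.line.rep (F'.vec (Sum.inr none) p.base)) • ContinuousLinearMap.id ℂ ℂ, ?_, ?_⟩
    · exact (F.contMDiffOn_ratio F').smul contMDiffOn_const
    · intro p hp v
      rw [F.trivO1_coordChange F' p hp v]
      rfl

instance (D : HolDistribution E M r) :
    ContMDiffVectorBundle ω ℂ D.O1 𝓘(ℂ, ProjModel E r) :=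
  D.preO1.contMDiffVectorBundle 𝓘(ℂ, ProjModel E r)

end HolDistribution

/-! ### Twisted differentials of forms with values in a line bundle -/

section TwistedDifferential

variable {G : Type*} [NormedAddCommGroup G] [NormedSpace ℂ G] [FiniteDimensional ℂ G]
    {Y : Type*} [TopologicalSpace Y] [ChartedSpace G Y]

/-- The expression of a 1-form `θ` on the complex manifold `Y` in the preferred chart at `p`. -/
noncomputable def oneFormInChart (θ : ∀ q : Y, TangentSpace 𝓘(ℂ, G) q →ₗ[ℂ] ℂ) (p : Y) (z : G) :
    G [⋀^Fin 1]→L[ℂ] ℂ :=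
  ContinuousAlternatingMap.ofSubsingleton ℂ G ℂ (0 : Fin 1)
    (LinearMap.toContinuousLinearMap (show G →ₗ[ℂ] ℂ from
      (θ ((chartAt G p).symm z)) ∘ₗ
        (mfderiv 𝓘(ℂ, G) 𝓘(ℂ, G) (chartAt G p).symm z).toLinearMap))

/-- The exterior derivative at `p` of a 1-form `θ` on `Y`, as a bilinear form on `T_p Y`; it is
computed in the preferred chart at `p`. -/
noncomputable def extDerivOneForm (θ : ∀ q : Y, TangentSpace 𝓘(ℂ, G) q →ₗ[ℂ] ℂ) (p : Y) :
    TangentSpace 𝓘(ℂ, G) p →ₗ[ℂ] TangentSpace 𝓘(ℂ, G) p →ₗ[ℂ] ℂ :=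
  let ω₂ : G [⋀^Fin 2]→L[ℂ] ℂ := extDeriv (oneFormInChart θ p) (chartAt G p p)
  let B : G →ₗ[ℂ] G →ₗ[ℂ] ℂ := LinearMap.mk₂ ℂ (fun u v => ω₂ ![u, v])
    (fun u u' v => ω₂.vecCons_add ![v] u u')
    (fun c u v => ω₂.vecCons_smul ![v] c u)
    (fun u v v' => by simpa using (ω₂.toAlternatingMap.curryLeft u).map_vecCons_add ![] v v')
    (fun c u v => by simpa using (ω₂.toAlternatingMap.curryLeft u).map_vecCons_smul ![] c v)
  let dφ : TangentSpace 𝓘(ℂ, G) p →ₗ[ℂ] G :=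
    (mfderiv 𝓘(ℂ, G) 𝓘(ℂ, G) (chartAt G p) p).toLinearMap
  B.compl₁₂ dφ dφ

theorem extDerivOneForm_apply (θ : ∀ q : Y, TangentSpace 𝓘(ℂ, G) q →ₗ[ℂ] ℂ) (p : Y)
    (u v : TangentSpace 𝓘(ℂ, G) p) :
    extDerivOneForm θ p u v = extDeriv (oneFormInChart θ p) (chartAt G p p)
      ![mfderiv 𝓘(ℂ, G) 𝓘(ℂ, G) (chartAt G p) p u,
        mfderiv 𝓘(ℂ, G) 𝓘(ℂ, G) (chartAt G p) p v] := rfl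

variable {L : Y → Type*} [∀ y, AddCommGroup (L y)] [∀ y, Module ℂ (L y)]
    [∀ y, TopologicalSpace (L y)] [TopologicalSpace (Bundle.TotalSpace ℂ L)] [FiberBundle ℂ L]

/-- `l` is a holomorphic section of the line bundle `L` in a neighborhood of `p`, with `l_p ≠ 0`,
and `ϑ = θ ⊗ l` in this neighborhood. -/
def IsLocalFactorization (ϑ : ∀ q : Y, TangentSpace 𝓘(ℂ, G) q →ₗ[ℂ] L q) (p : Y)
    (l : ∀ q : Y, L q) (θ : ∀ q : Y, TangentSpace 𝓘(ℂ, G) q →ₗ[ℂ] ℂ) : Prop :=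
  ∃ O : Set Y, IsOpen O ∧ p ∈ O ∧
    ContMDiffOn 𝓘(ℂ, G) (𝓘(ℂ, G).prod 𝓘(ℂ, ℂ)) ω (fun q => Bundle.TotalSpace.mk' ℂ q (l q)) O ∧
    l p ≠ 0 ∧ ∀ q ∈ O, ∀ u : TangentSpace 𝓘(ℂ, G) q, ϑ q u = θ q u • l q

variable [VectorBundle ℂ ℂ L] [ContMDiffVectorBundle ω ℂ L 𝓘(ℂ, G)]

theorem exists_isLocalFactorization (ϑ : ∀ q : Y, TangentSpace 𝓘(ℂ, G) q →ₗ[ℂ] L q) (p : Y) :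
    ∃ l θ, IsLocalFactorization ϑ p l θ := by
  set t := trivializationAt ℂ L p with ht
  have hp : p ∈ t.baseSet := FiberBundle.mem_baseSet_trivializationAt' p
  have h1 : ∀ q ∈ t.baseSet, (t ⟨q, t.symm q 1⟩).2 = 1 := fun q hq =>
    congrArg Prod.snd (t.apply_mk_symm hq 1)
  refine ⟨fun q => t.symm q 1, fun q => (t.linearMapAt ℂ q) ∘ₗ ϑ q, t.baseSet, t.open_baseSet, hp,
    ?_, ?_, ?_⟩
  · rw [t.contMDiffOn_section_baseSet_iff]
    exact contMDiffOn_const.congr h1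
  · intro h0
    have h2 := h1 p hp
    change t.symm p 1 = 0 at h0
    rw [h0] at h2
    have h3 := (t.linearMapAt ℂ p).map_zero
    rw [t.coe_linearMapAt_of_mem (R := ℂ) hp] at h3
    exact one_ne_zero (h2.symm.trans h3)
  · intro q hq u
    apply (t.linearEquivAt ℂ q hq).injective
    rw [map_smul]
    have h4 : t.linearEquivAt ℂ q hq (t.symm q 1) = 1 := h1 q hq
    rw [h4, smul_eq_mul, mul_one, LinearMap.comp_apply,
      t.coe_linearMapAt_of_mem (R := ℂ) hq]
    rfl

/-- The twisted differential `d_p ϑ : Ker(ϑ_p) × Ker(ϑ_p) → L_p` of an `L`-valued form `ϑ`: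
choose a local section `l` of `L` with `l_p ≠ 0` and a 1-form `θ` such that `ϑ = θ ⊗ l` near `p`,
and put `(d_p ϑ)(u, v) = dθ(u, v) • l_p`. -/
noncomputable def twistedDifferential (ϑ : ∀ q : Y, TangentSpace 𝓘(ℂ, G) q →ₗ[ℂ] L q) (p : Y) :
    LinearMap.ker (ϑ p) →ₗ[ℂ] LinearMap.ker (ϑ p) →ₗ[ℂ] L p :=
  ((extDerivOneForm (exists_isLocalFactorization ϑ p).choose_spec.choose p).compl₁₂
    (LinearMap.ker (ϑ p)).subtype (LinearMap.ker (ϑ p)).subtype).compr₂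
    (LinearMap.toSpanSingleton ℂ (L p) ((exists_isLocalFactorization ϑ p).choose p))

/-- `Null(d_p ϑ) = {v ∈ Ker(ϑ_p) : (d_p ϑ)(u, v) = 0 for all u ∈ Ker(ϑ_p)}`. -/
noncomputable def nullTwistedDifferential (ϑ : ∀ q : Y, TangentSpace 𝓘(ℂ, G) q →ₗ[ℂ] L q)
    (p : Y) : Submodule ℂ (LinearMap.ker (ϑ p)) where
  carrier := {v | ∀ u : LinearMap.ker (ϑ p), twistedDifferential ϑ p u v = 0}
  add_mem' := by intro a b ha hb u; rw [map_add, ha u, hb u, add_zero]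
  zero_mem' := by intro u; rw [map_zero]
  smul_mem' := by intro c a ha u; rw [map_smul, ha u, smul_zero]

end TwistedDifferential

/-! ### The contact form of `ℙ T^∨ M` and its restriction to `ℙ D^⊥` -/

section ContactForm

variable {E : Type*} [NormedAddCommGroup E] [NormedSpace ℂ E] [FiniteDimensional ℂ E]
    {M : Type*} [TopologicalSpace M] [ChartedSpace E M] [IsManifold 𝓘(ℂ, E) ω M] {r : ℕ}

/-- The projectivized cotangent bundle `ℙ T^∨ M`, i.e. `ℙ D^⊥` for `D = 0`. -/
abbrev ProjCotangent (E : Type*) [NormedAddCommGroup E] [NormedSpace ℂ E]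
    (M : Type*) [TopologicalSpace M] [ChartedSpace E M] [IsManifold 𝓘(ℂ, E) ω M] : Type _ :=
  (HolDistribution.zero E M).ProjPerp

/-- The `O(1)`-valued form `ϑ^M` on `ℙ T^∨ M`. It sends a tangent vector `u` at `[α]` to the
element `β ↦ β(dϖ(u))` of `O(1)_{[α]} = Hom(ℂα, ℂ)`, where `ϖ : ℙ T^∨ M → M` is the projection;
this element is `α(dϖ(u)) • α^∨`, where `α^∨ ∈ Hom(ℂα, ℂ)` satisfies `α^∨(α) = 1`. -/
noncomputable def contactForm (E : Type*) [NormedAddCommGroup E] [NormedSpace ℂ E]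
    [FiniteDimensional ℂ E]
    (M : Type*) [TopologicalSpace M] [ChartedSpace E M] [IsManifold 𝓘(ℂ, E) ω M]
    (p : ProjCotangent E M) :
    TangentSpace 𝓘(ℂ, HolDistribution.ProjModel E 0) p →ₗ[ℂ] (HolDistribution.zero E M).O1 p :=
  (HolDistribution.zero E M).evalO1 p ∘ₗ
    (mfderiv 𝓘(ℂ, HolDistribution.ProjModel E 0) 𝓘(ℂ, E)
      (HolDistribution.zero E M).proj p).toLinearMap

theorem contactForm_eq_smul (p : ProjCotangent E M)
    (u : TangentSpace 𝓘(ℂ, HolDistribution.ProjModel E 0) p)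
    (α : p.line.submodule) (hα : α ≠ 0)
    (αv : Module.Dual ℂ p.line.submodule) (hαv : αv α = 1) :
    (show Module.Dual ℂ p.line.submodule from contactForm E M p u) =
      (α : Module.Dual ℂ (TangentSpace 𝓘(ℂ, E) p.base))
        (mfderiv 𝓘(ℂ, HolDistribution.ProjModel E 0) 𝓘(ℂ, E)
          (HolDistribution.zero E M).proj p u) • αv := by
  refine LinearMap.ext fun β => ?_
  obtain ⟨c, rfl⟩ := (finrank_eq_one_iff_of_nonzero' α hα).1 p.line.finrank_submodule β
  rw [LinearMap.smul_apply, map_smul, map_smul, hαv]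
  simp only [smul_eq_mul, mul_one]
  exact mul_comm _ _

namespace HolDistribution

/-- The inclusion `ℙ D^⊥ ⊂ ℙ T^∨ M`. -/
def incl (D : HolDistribution E M r) (p : D.ProjPerp) : ProjCotangent E M where
  base := p.base
  line := p.line
  le := by
    rw [show (zero E M).perp p.base = ⊤ from Submodule.dualAnnihilator_bot]
    exact le_top

/-- The restriction `ϑ^M|_{ℙ D^⊥}`, i.e. the pull-back of `ϑ^M` to `ℙ D^⊥` under the inclusion.
Its values lie in the fibres of the restriction of `O(1)` to `ℙ D^⊥`, which is the line bundle
`O(1)` of `ℙ D^⊥`. -/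
noncomputable def contactFormRestrict (D : HolDistribution E M r) (p : D.ProjPerp) :
    TangentSpace 𝓘(ℂ, ProjModel E r) p →ₗ[ℂ] D.O1 p :=
  show TangentSpace 𝓘(ℂ, ProjModel E r) p →ₗ[ℂ] (zero E M).O1 (D.incl p) from
    contactForm E M (D.incl p) ∘ₗ
      (mfderiv 𝓘(ℂ, ProjModel E r) 𝓘(ℂ, ProjModel E 0) D.incl p).toLinearMap

end HolDistribution

end ContactForm

/-! An adapted frame s_i, t_0, t_1, ..., t_k gives a chart of ℙ D^⊥ with coordinates (x, a). The
covector normalized by α(t_0) = 1 is there τ_0 + Σ a_j τ_j, where τ_0, ..., τ_k are the dual coframe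
elements that cut out D. Evaluating ϑ on this covector gives the scalar form η = τ_0 + Σ a_j τ_j
(`coordForm`), which is affine in a and sees only the E-component of a tangent vector. Hence dη((e,
b), (e', b')) = Σ b_j τ_j(e') - Σ b'_j τ_j(e) + B(e, e'), where B (`coordBracket`) is the exterior
derivative with a held fixed; this is `fderiv_coordForm_sub_eq`. Cartan's formula shows that on D_x
the form B is minus the normalized covector composed with the Levi tensor (`fderiv_coordForm_sub`,
`coordBracket_eq_zero_iff`).

The rest is linear algebra on Ker η = {(e, b) : η(e) = 0}. Let (e', b') be in the null space.
Testing against (0, b) gives τ_j(e') = 0 for all j, and with η(e') = 0 this puts e' in D_x. Testing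
against e in D_x gives B(e, e') = 0, so e' is null for the Levi form. If e' = 0, then Σ b'_j τ_j
vanishes on the kernel of η in E, where the τ_j are independent (`exists_coordForm_eq_zero`); so b'
= 0 and the projection is injective. Conversely, if e' is null for the Levi form, then B(·, e')
restricted to that kernel vanishes on the common zeros of the τ_j, so it is a combination of them,
and its coefficients give the missing b' (`exists_forall_null`).

Two reductions lead to this computation. The differential of the inclusion into ℙ T^∨ M is removed
by the chain rule (`contactFormRestrict_apply`). Any factorization ϑ = θ ⊗ l makes η a nonvanishing
multiple of θ in the chart, so dη and dθ are proportional on the kernel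
(`exists_mul_extDerivOneForm_eq`). -/

/-! ### Exterior derivatives and rescaling of 1-forms on a vector space -/

section OneForm

variable {G : Type*} [NormedAddCommGroup G] [NormedSpace ℂ G]

theorem extDeriv_ofSubsingleton_apply {η : G → G →L[ℂ] ℂ} {z : G} (h : DifferentiableAt ℂ η z)
    (u v : G) :
    extDeriv (fun z => ContinuousAlternatingMap.ofSubsingleton ℂ G ℂ (0 : Fin 1) (η z)) z ![u, v] =
      fderiv ℂ η z u v - fderiv ℂ η z v u := by
  have h' : DifferentiableAt ℂ
      (fun z => ContinuousAlternatingMap.ofSubsingleton ℂ G ℂ (0 : Fin 1) (η z)) z :=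
    (ContinuousAlternatingMap.ofSubsingletonLIE (𝕜 := ℂ) (E := G) (F := ℂ)
      (0 : Fin 1)).toContinuousLinearEquiv.differentiableAt.comp z h
  have hw : ∀ w : G, fderiv ℂ (fun y => η y w) z = (fderiv ℂ η z).flip w := fun w => by
    ext t
    rw [fderiv_clm_apply h (differentiableAt_const w)]
    simp
  rw [extDeriv_apply h', Fin.sum_univ_two]
  simp [Fin.removeNth, hw, sub_eq_add_neg]

/-- A local factorization imposes no regularity on its scalar form θ. Differentiability is recovered
here by dividing a differentiable form by the nonvanishing function g. -/
theorem differentiableAt_of_smul {η Λ : G → G →L[ℂ] ℂ} {g : G → ℂ} {z : G}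
    (hg : DifferentiableAt ℂ g z) (hgz : g z ≠ 0) (hΛ : DifferentiableAt ℂ Λ z)
    (h : ∀ᶠ y in 𝓝 z, Λ y = g y • η y) : DifferentiableAt ℂ η z := by
  have h1 : DifferentiableAt ℂ (fun y => (g y)⁻¹ • Λ y) z := (hg.inv hgz).smul hΛ
  refine h1.congr_of_eventuallyEq ?_
  filter_upwards [h, hg.continuousAt.eventually_ne hgz] with y hy hy0
  rw [hy, smul_smul, inv_mul_cancel₀ hy0, one_smul]

/-- The Leibniz term dg(u) η(v) drops out on the kernel of η. This is why the twisted differential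
does not depend on the trivializing section. -/
theorem fderiv_smul_apply_of_apply_eq_zero {η Λ : G → G →L[ℂ] ℂ} {g : G → ℂ} {z : G}
    (hg : DifferentiableAt ℂ g z) (hη : DifferentiableAt ℂ η z)
    (h : ∀ᶠ y in 𝓝 z, Λ y = g y • η y) {v : G} (hv : η z v = 0) (u : G) :
    fderiv ℂ Λ z u v = g z * fderiv ℂ η z u v := by
  rw [Filter.EventuallyEq.fderiv_eq h, fderiv_fun_smul hg hη]
  simp [hv]

end OneForm

/-! ### Linear algebra of the null space of dη -/

section NullSpace

variable {V κ : Type*} [AddCommGroup V] [Module ℂ V] [Fintype κ]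
  {l : Module.Dual ℂ V} {ξ : κ → Module.Dual ℂ V} {B : V →ₗ[ℂ] V →ₗ[ℂ] ℂ}

/-- Test against the purely vertical vectors (0, b), with b a standard basis vector. -/
theorem apply_eq_zero_of_forall_null {x : V} {a : κ → ℂ}
    (h : ∀ (u : V) (b : κ → ℂ), l u = 0 →
      ∑ j, b j * ξ j x - ∑ j, a j * ξ j u + B u x = 0) (j : κ) : ξ j x = 0 := by
  classical
  simpa [Pi.single_apply] using h 0 (Pi.single j 1) (map_zero l)

/-- Test against vectors in the kernel of `l` that are dual to the `ξ j`; only the coefficient `a i`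
survives. -/
theorem eq_zero_of_forall_null (hs : ∀ b : κ → ℂ, ∃ v, l v = 0 ∧ ∀ j, ξ j v = b j)
    {a : κ → ℂ} (h : ∀ (u : V) (b : κ → ℂ), l u = 0 →
      ∑ j, b j * ξ j 0 - ∑ j, a j * ξ j u + B u 0 = 0) : a = 0 := by
  classical
  funext i
  obtain ⟨v, hv, hv'⟩ := hs (Pi.single i 1)
  simpa [hv', Pi.single_apply] using h v 0 hv

/-- On the kernel of `l`, the functional `B · x` vanishes on the common zeros of the `ξ j`, so there
it is a linear combination of them. The vector `a` lists its coefficients, read off on a dual family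
`e`. -/
theorem exists_forall_null (hs : ∀ b : κ → ℂ, ∃ v, l v = 0 ∧ ∀ j, ξ j v = b j) {x : V}
    (hx : ∀ j, ξ j x = 0) (hB : ∀ u, l u = 0 → (∀ j, ξ j u = 0) → B u x = 0) :
    ∃ a : κ → ℂ, ∀ (u : V) (b : κ → ℂ), l u = 0 →
      ∑ j, b j * ξ j x - ∑ j, a j * ξ j u + B u x = 0 := by
  classical
  choose e he he' using fun i : κ => hs (Pi.single i 1)
  refine ⟨fun j => B (e j) x, fun u b hu => ?_⟩
  -- Subtracting the components along the dual family projects the kernel of `l` onto the common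
  -- zeros of the `ξ j`.
  have h := hB (u - ∑ j, ξ j u • e j) (by simp [hu, he]) fun i => by
    simp [he', Pi.single_apply]
  have h2 : B u x = ∑ j, ξ j u * B (e j) x := by
    simpa [sub_eq_zero, LinearMap.sum_apply] using h
  rw [h2]
  simp [hx, mul_comm]

end NullSpace

/-! ### Charts of ℙ D^⊥, differentiability of the projection and the inclusion -/

namespace HolDistribution

variable {E : Type*} [NormedAddCommGroup E] [NormedSpace ℂ E] [FiniteDimensional ℂ E]
    {M : Type*} [TopologicalSpace M] [ChartedSpace E M] [IsManifold 𝓘(ℂ, E) ω M] {r : ℕ}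

namespace AdaptedFrame

variable {D : HolDistribution E M r} (F : D.AdaptedFrame)

/-- The chart of `ℙ D^⊥` attached to an adapted frame, as a homeomorphism of open sets. -/
noncomputable def projHomeo : OpenPartialHomeomorph D.ProjPerp (ProjModel E r) :=
  D.projCore.openPartialHomeomorph F.projChart ⟨F, rfl⟩

/-- The exterior derivative is defined through the preferred chart at p, so the frame has to be the
one that produces this very chart. -/
theorem exists_chartAt_eq (p : D.ProjPerp) :
    ∃ F : D.AdaptedFrame, p ∈ F.projHomeo.source ∧ chartAt (ProjModel E r) p = F.projHomeo :=
  ⟨(exists_mem_source p).choose, (exists_mem_source p).choose_spec, rfl⟩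

theorem projHomeo_mem_atlas : F.projHomeo ∈ atlas (ProjModel E r) D.ProjPerp := by
  change _ ∈ ⋃ (e : PartialEquiv _ _) (he : e ∈ D.projCore.atlas), _
  simp only [Set.mem_iUnion, Set.mem_singleton_iff]
  exact ⟨F.projChart, ⟨F, rfl⟩, rfl⟩

theorem mdifferentiable_projHomeo :
    F.projHomeo.MDifferentiable 𝓘(ℂ, ProjModel E r) 𝓘(ℂ, ProjModel E r) := by
  have := IsManifold.of_le (I := 𝓘(ℂ, ProjModel E r)) (M := D.ProjPerp) (m := 1) (n := ω) le_top
  exact mdifferentiable_of_mem_atlas F.projHomeo_mem_atlas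

theorem mdifferentiable_chart : F.chart.MDifferentiable 𝓘(ℂ, E) 𝓘(ℂ, E) := by
  have := IsManifold.of_le (I := 𝓘(ℂ, E)) (M := M) (m := 1) (n := ω) le_top
  exact mdifferentiable_of_mem_atlas F.chart_mem

theorem chart_symm_projHomeo_fst {p : D.ProjPerp} (hp : p ∈ F.projHomeo.source) :
    F.chart.symm (F.projHomeo p).1 = p.base :=
  F.chart.left_inv (F.dom_subset hp.1)

/-- At the coordinates of p, `form` is the representative of the line that takes the value 1 on t_0.
-/
theorem form_projHomeo {p : D.ProjPerp} (hp : p ∈ F.projHomeo.source)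
    (W : ∀ y : M, TangentSpace 𝓘(ℂ, E) y) :
    F.form (F.chart.symm (F.projHomeo p).1) (F.projHomeo p).2 (W (F.chart.symm (F.projHomeo p).1)) =
      p.line.rep (W p.base) / p.line.rep (F.vec (Sum.inr none) p.base) := by
  -- The point read back from the chart equals `p.base` only propositionally, while covectors and
  -- vectors live over it. Generalizing the base point lets the equality be substituted.
  have key : ∀ y : M, y = p.base → F.form y (F.projHomeo p).2 (W y) =
      p.line.rep (W p.base) / p.line.rep (F.vec (Sum.inr none) p.base) := by
    rintro y rfl
    refine (LinearMap.congr_fun (F.eq_form hp.1 p.rep_mem hp.2) _).trans ?_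
    rw [LinearMap.smul_apply, smul_eq_mul, div_eq_inv_mul]
  exact key _ (F.chart_symm_projHomeo_fst hp)

theorem hasMFDerivAt_proj {p : D.ProjPerp} (hp : p ∈ F.projHomeo.source) :
    HasMFDerivAt 𝓘(ℂ, ProjModel E r) 𝓘(ℂ, E) D.proj p
      ((mfderiv 𝓘(ℂ, E) 𝓘(ℂ, E) F.chart.symm (F.projHomeo p).1).comp
        ((ContinuousLinearMap.fst ℂ E (Fin (projDim E r) → ℂ)).comp
          (mfderiv 𝓘(ℂ, ProjModel E r) 𝓘(ℂ, ProjModel E r) F.projHomeo p))) := by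
  have h1 := (F.mdifferentiable_projHomeo.mdifferentiableAt hp).hasMFDerivAt
  have h2 : HasMFDerivAt 𝓘(ℂ, ProjModel E r) 𝓘(ℂ, E) (Prod.fst : ProjModel E r → E)
      (F.projHomeo p) (ContinuousLinearMap.fst ℂ E (Fin (projDim E r) → ℂ)) :=
    hasFDerivAt_fst.hasMFDerivAt
  have h3 : HasMFDerivAt 𝓘(ℂ, E) 𝓘(ℂ, E) F.chart.symm (F.projHomeo p).1 _ :=
    (F.mdifferentiable_chart.mdifferentiableAt_symm (x := (F.projHomeo p).1)
      (F.projHomeo.map_source hp).1).hasMFDerivAt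
  refine (HasMFDerivAt.comp p h3 (HasMFDerivAt.comp p h2 h1)).congr_of_eventuallyEq ?_
  filter_upwards [F.projHomeo.open_source.mem_nhds hp] with q hq
  exact (F.chart_symm_projHomeo_fst hq).symm

end AdaptedFrame

theorem mdifferentiableAt_proj (D : HolDistribution E M r) (p : D.ProjPerp) :
    MDifferentiableAt 𝓘(ℂ, ProjModel E r) 𝓘(ℂ, E) D.proj p := by
  obtain ⟨F, hF, -⟩ := AdaptedFrame.exists_chartAt_eq p
  exact (F.hasMFDerivAt_proj hF).mdifferentiableAt

/-- In the charts of two adapted frames, one for D and one for the zero distribution, the inclusion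
is a change of chart on M together with quotients of values of the normalized covector, hence
holomorphic. Without differentiability `mfderiv` would be zero by convention and the pulled-back
form would be meaningless. -/
theorem mdifferentiableAt_incl (D : HolDistribution E M r) (p : D.ProjPerp) :
    MDifferentiableAt 𝓘(ℂ, ProjModel E r) 𝓘(ℂ, ProjModel E 0) D.incl p := by
  obtain ⟨F, hF, -⟩ := AdaptedFrame.exists_chartAt_eq p
  obtain ⟨F', hF', -⟩ := AdaptedFrame.exists_chartAt_eq (D.incl p)
  set S : Set (ProjModel E r) :=
    {z | z.1 ∈ F.chart.target ∧ F.chart.symm z.1 ∈ F.dom ∩ F'.dom} with hS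
  have hSo : IsOpen S := F.isOpen_coord F'.isOpen_dom
  let f : Option (Fin (projDim E 0)) → ProjModel E r → ℂ := fun o z =>
    F.form (F.chart.symm z.1) z.2 (F'.vec (Sum.inr o) (F.chart.symm z.1))
  have hf : ∀ o, ContDiffOn ℂ ω (f o) S := fun o =>
    F.contDiffOn_form F'.isOpen_dom (F'.hol_vec (Sum.inr o))
  have hfq : ∀ q ∈ F.projHomeo.source, ∀ o, f o (F.projHomeo q) =
      q.line.rep (F'.vec (Sum.inr o) q.base) / q.line.rep (F.vec (Sum.inr none) q.base) :=
    fun q hq o => F.form_projHomeo hq (F'.vec (Sum.inr o))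
  -- The inclusion in coordinates: change the chart of M and renormalize the covector to be 1 on the
  -- t_0 of the second frame.
  let c : ProjModel E r → ProjModel E 0 := fun z =>
    (F'.chart (F.chart.symm z.1), fun j => f (some j) z / f none z)
  have hzS : F.projHomeo p ∈ S := by
    refine ⟨(F.projHomeo.map_source hF).1, (F.projHomeo.map_source hF).2, ?_⟩
    rw [F.chart_symm_projHomeo_fst hF]
    exact hF'.1
  have hz0 : f none (F.projHomeo p) ≠ 0 := by
    rw [hfq p hF]
    exact div_ne_zero hF'.2 hF.2
  have hcf : ∀ o, DifferentiableAt ℂ (f o) (F.projHomeo p) := fun o =>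
    ((hf o).contDiffAt (hSo.mem_nhds hzS)).differentiableAt (by simp)
  have hcd : DifferentiableAt ℂ c (F.projHomeo p) := by
    refine DifferentiableAt.prodMk ?_ ?_
    · have h1 : MDifferentiableAt 𝓘(ℂ, E) 𝓘(ℂ, E) F.chart.symm (F.projHomeo p).1 :=
        F.mdifferentiable_chart.mdifferentiableAt_symm hzS.1
      have h2 : MDifferentiableAt 𝓘(ℂ, E) 𝓘(ℂ, E) F'.chart (F.chart.symm (F.projHomeo p).1) :=
        F'.mdifferentiable_chart.mdifferentiableAt (F'.dom_subset hzS.2.2)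
      have h3 := (MDifferentiableAt.comp _ h2 h1).differentiableAt
      exact DifferentiableAt.comp (g := F'.chart ∘ F.chart.symm) (F.projHomeo p) h3
        differentiableAt_fst
    · rw [differentiableAt_pi]
      intro j
      simp only [div_eq_mul_inv]
      exact (hcf (some j)).mul ((hcf none).inv hz0)
  have hcp : c (F.projHomeo p) ∈ F'.projHomeo.target := by
    have : F'.chart.symm (F'.chart (F.chart.symm (F.projHomeo p).1)) =
      F.chart.symm (F.projHomeo p).1 := F'.chart.left_inv (F'.dom_subset hzS.2.2)
    refine ⟨F'.chart.map_source (F'.dom_subset hzS.2.2), ?_⟩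
    change F'.chart.symm (F'.chart (F.chart.symm (F.projHomeo p).1)) ∈ _
    rw [this]
    exact hzS.2.2
  have h := (F'.mdifferentiable_projHomeo.mdifferentiableAt_symm hcp).comp p
    (hcd.mdifferentiableAt.comp p (F.mdifferentiable_projHomeo.mdifferentiableAt hF))
  refine h.congr_of_eventuallyEq ?_
  have hev : ∀ᶠ z in 𝓝 (F.projHomeo p), z ∈ S ∧ f none z ≠ 0 :=
    Filter.Eventually.and (hSo.mem_nhds hzS) ((hcf none).continuousAt.eventually_ne hz0)
  filter_upwards [F.projHomeo.open_source.mem_nhds hF,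
    (F.projHomeo.continuousAt hF).eventually hev] with q hq hqS
  have hb := F.chart_symm_projHomeo_fst hq
  have hq' : D.incl q ∈ F'.projHomeo.source := by
    refine ⟨?_, ?_⟩
    · have := hqS.1.2.2
      rw [hb] at this
      exact this
    · have := hqS.2
      rw [hfq q hq] at this
      exact (div_ne_zero_iff.1 this).1
  have hc : c (F.projHomeo q) = F'.projHomeo (D.incl q) := by
    refine Prod.ext (congrArg F'.chart hb) ?_
    funext j
    refine (congrArg₂ (· / ·) (hfq q hq (some j)) (hfq q hq none)).trans ?_
    exact div_div_div_cancel_right₀ hq.2 _ _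
  change D.incl q = F'.projHomeo.symm (c (F.projHomeo q))
  rw [hc]
  exact (F'.projHomeo.left_inv hq').symm

/-- Chain rule: the inclusion followed by the projection of ℙ T^∨ M is the projection of ℙ D^⊥. -/
theorem contactFormRestrict_apply (D : HolDistribution E M r) (p : D.ProjPerp)
    (u : TangentSpace 𝓘(ℂ, ProjModel E r) p) :
    D.contactFormRestrict p u =
      D.evalO1 p (mfderiv 𝓘(ℂ, ProjModel E r) 𝓘(ℂ, E) D.proj p u) := by
  have h := mfderiv_comp p ((zero E M).mdifferentiableAt_proj (D.incl p))
    (D.mdifferentiableAt_incl p)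
  have h' : mfderiv 𝓘(ℂ, ProjModel E r) 𝓘(ℂ, E) D.proj p =
      (mfderiv 𝓘(ℂ, ProjModel E 0) 𝓘(ℂ, E) (zero E M).proj (D.incl p)).comp
        (mfderiv 𝓘(ℂ, ProjModel E r) 𝓘(ℂ, ProjModel E 0) D.incl p) := h
  rw [h']
  rfl

end HolDistribution

/-! ### The contact form in coordinates and Cartan's formula -/

theorem mlieBracket_eq_lieBracket {E : Type*} [NormedAddCommGroup E] [NormedSpace ℂ E]
    (U V : ∀ x : E, TangentSpace 𝓘(ℂ, E) x) (x : E) :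
    VectorField.mlieBracket 𝓘(ℂ, E) U V x = VectorField.lieBracket ℂ (E := E) U V x := by
  rw [← VectorField.mlieBracketWithin_univ, VectorField.mlieBracketWithin_eq_lieBracketWithin]
  exact congrFun VectorField.lieBracketWithin_univ x

namespace HolDistribution

variable {E : Type*} [NormedAddCommGroup E] [NormedSpace ℂ E] [FiniteDimensional ℂ E]
    {M : Type*} [TopologicalSpace M] [ChartedSpace E M] [IsManifold 𝓘(ℂ, E) ω M] {r : ℕ}

namespace AdaptedFrame

variable {D : HolDistribution E M r} (F : D.AdaptedFrame)

/-- The derivative of the inverse of the chart of `M` underlying an adapted frame. -/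
noncomputable def symmDeriv (x : E) :
    TangentSpace 𝓘(ℂ, E) x →L[ℂ] TangentSpace 𝓘(ℂ, E) (F.chart.symm x) :=
  mfderiv 𝓘(ℂ, E) 𝓘(ℂ, E) F.chart.symm x

/-- The derivative of the chart of `M` underlying an adapted frame, at the point with
coordinates `x`. -/
noncomputable def chartDeriv (x : E) :
    TangentSpace 𝓘(ℂ, E) (F.chart.symm x) →L[ℂ] TangentSpace 𝓘(ℂ, E) x :=
  mfderiv 𝓘(ℂ, E) 𝓘(ℂ, E) F.chart (F.chart.symm x)

theorem chartDeriv_comp_symmDeriv {x : E} (hx : x ∈ F.chart.target) :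
    (F.chartDeriv x).comp (F.symmDeriv x) = ContinuousLinearMap.id ℂ _ :=
  F.mdifferentiable_chart.comp_symm_deriv hx

theorem symmDeriv_comp_chartDeriv {x : E} (hx : x ∈ F.chart.target) :
    (F.symmDeriv x).comp (F.chartDeriv x) = ContinuousLinearMap.id ℂ _ := by
  have h := F.mdifferentiable_chart.symm_comp_deriv (F.chart.map_target hx)
  -- The cited identity differentiates the inverse chart at `F.chart (F.chart.symm x)`, which has to
  -- be replaced by x.
  have key : ∀ x' : E, x' = x → ((show E →L[ℂ] E from
      mfderiv 𝓘(ℂ, E) 𝓘(ℂ, E) F.chart.symm x').comp (show E →L[ℂ] E from F.chartDeriv x)) =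
      ContinuousLinearMap.id ℂ E → (show E →L[ℂ] E from (F.symmDeriv x)).comp
        (show E →L[ℂ] E from F.chartDeriv x) = ContinuousLinearMap.id ℂ E := by
    rintro x' rfl h
    exact h
  exact key _ (F.chart.right_inv hx) h

theorem symmDeriv_chartDeriv {x : E} (hx : x ∈ F.chart.target)
    (w : TangentSpace 𝓘(ℂ, E) (F.chart.symm x)) : F.symmDeriv x (F.chartDeriv x w) = w :=
  DFunLike.congr_fun (F.symmDeriv_comp_chartDeriv hx) w

theorem chartDeriv_symmDeriv {x : E} (hx : x ∈ F.chart.target)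
    (w : TangentSpace 𝓘(ℂ, E) x) : F.chartDeriv x (F.symmDeriv x w) = w :=
  DFunLike.congr_fun (F.chartDeriv_comp_symmDeriv hx) w

/-- The expression of a vector field on `M` in the chart underlying an adapted frame. -/
noncomputable def pullField (V : ∀ y : M, TangentSpace 𝓘(ℂ, E) y) (x : E) : E :=
  VectorField.mpullback 𝓘(ℂ, E) 𝓘(ℂ, E) F.chart.symm V x

theorem pullField_apply {x : E} (hx : x ∈ F.chart.target)
    (V : ∀ y : M, TangentSpace 𝓘(ℂ, E) y) :
    F.pullField V x = F.chartDeriv x (V (F.chart.symm x)) := by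
  exact DFunLike.congr_fun (ContinuousLinearMap.inverse_eq (F.symmDeriv_comp_chartDeriv hx)
    (F.chartDeriv_comp_symmDeriv hx)) _

theorem contMDiffAt_chart_symm {x : E} (hx : x ∈ F.chart.target) :
    ContMDiffAt 𝓘(ℂ, E) 𝓘(ℂ, E) ω F.chart.symm x :=
  (contMDiffOn_symm_of_mem_maximalAtlas
    (IsManifold.subset_maximalAtlas F.chart_mem)).contMDiffAt (F.chart.open_target.mem_nhds hx)

/-- Naturality of the Lie bracket under pullback turns the bracket on M into the explicit bracket of
E. -/
theorem chartDeriv_mlieBracket {x : E} (hx : x ∈ F.chart.target)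
    {U V : ∀ y : M, TangentSpace 𝓘(ℂ, E) y}
    (hU : MDifferentiableAt 𝓘(ℂ, E) (𝓘(ℂ, E).prod 𝓘(ℂ, E))
      (fun y => Bundle.TotalSpace.mk' E y (U y)) (F.chart.symm x))
    (hV : MDifferentiableAt 𝓘(ℂ, E) (𝓘(ℂ, E).prod 𝓘(ℂ, E))
      (fun y => Bundle.TotalSpace.mk' E y (V y)) (F.chart.symm x)) :
    F.chartDeriv x (VectorField.mlieBracket 𝓘(ℂ, E) U V (F.chart.symm x)) =
      VectorField.lieBracket ℂ (F.pullField U) (F.pullField V) x := by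
  have hb := VectorField.mpullback_mlieBracket (I := 𝓘(ℂ, E)) (n := ω) hU hV
    (F.contMDiffAt_chart_symm hx) le_top
  exact ((F.pullField_apply hx _).symm.trans hb).trans (mlieBracket_eq_lieBracket _ _ x)

theorem isInvertible_symmDeriv {x : E} (hx : x ∈ F.chart.target) : (F.symmDeriv x).IsInvertible :=
  ContinuousLinearMap.IsInvertible.of_inverse (F.symmDeriv_comp_chartDeriv hx)
    (F.chartDeriv_comp_symmDeriv hx)

theorem isInvertible_chartDeriv {x : E} (hx : x ∈ F.chart.target) :
    (F.chartDeriv x).IsInvertible :=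
  ContinuousLinearMap.IsInvertible.of_inverse (F.chartDeriv_comp_symmDeriv hx)
    (F.symmDeriv_comp_chartDeriv hx)

theorem contMDiffAt_chart {y : M} (hy : y ∈ F.chart.source) :
    ContMDiffAt 𝓘(ℂ, E) 𝓘(ℂ, E) ω F.chart y :=
  (contMDiffOn_of_mem_maximalAtlas
    (IsManifold.subset_maximalAtlas F.chart_mem)).contMDiffAt (F.chart.open_source.mem_nhds hy)

theorem differentiableAt_pullField {x : E} (hx : x ∈ F.chart.target)
    {V : ∀ y : M, TangentSpace 𝓘(ℂ, E) y}
    (hV : ContMDiffAt 𝓘(ℂ, E) (𝓘(ℂ, E).prod 𝓘(ℂ, E)) ω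
      (fun y => Bundle.TotalSpace.mk' E y (V y)) (F.chart.symm x)) :
    DifferentiableAt ℂ (F.pullField V) x := by
  have h := ContMDiffAt.mpullback_vectorField_preimage hV (F.contMDiffAt_chart_symm hx)
    (F.isInvertible_symmDeriv hx) (m := ω) le_top
  exact (contMDiffAt_vectorSpace_iff_contDiffAt.1 h).differentiableAt (by simp)

/-- The coordinate vector field on `M` in the chart underlying an adapted frame. -/
noncomputable def coordField (e : E) (y : M) : TangentSpace 𝓘(ℂ, E) y :=
  VectorField.mpullback 𝓘(ℂ, E) 𝓘(ℂ, E) F.chart (fun _ => e) y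

theorem coordField_symm {x : E} (hx : x ∈ F.chart.target) (e : E) :
    F.coordField e (F.chart.symm x) = F.symmDeriv x e := by
  exact DFunLike.congr_fun (ContinuousLinearMap.inverse_eq (F.chartDeriv_comp_symmDeriv hx)
    (F.symmDeriv_comp_chartDeriv hx)) _

/-- Coordinate fields express the values of `coordForm` on fixed vectors as values of `form` on
holomorphic fields, so that `contDiffOn_form` yields the holomorphy of `coordForm`. -/
theorem holVectorFieldOn_coordField (e : E) :
    HolVectorFieldOn (F.coordField e) F.chart.source := by
  intro y hy
  apply ContMDiffAt.contMDiffWithinAt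
  have he : ContMDiffAt 𝓘(ℂ, E) 𝓘(ℂ, E).tangent ω
      (fun x : E => (⟨x, e⟩ : TangentBundle 𝓘(ℂ, E) E)) (F.chart y) :=
    contMDiffAt_vectorSpace_iff_contDiffAt.2 contDiffAt_const
  have hy' : F.chart.symm (F.chart y) = y := F.chart.left_inv hy
  have hinv := F.isInvertible_chartDeriv (F.chart.map_source hy)
  rw [chartDeriv] at hinv
  rw [hy'] at hinv
  exact ContMDiffAt.mpullback_vectorField_preimage he (F.contMDiffAt_chart hy) hinv le_top

/-- The normalized contact form of `ℙ D^⊥` in the chart attached to an adapted frame. -/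
noncomputable def coordForm (z : ProjModel E r) : ProjModel E r →L[ℂ] ℂ :=
  (LinearMap.toContinuousLinearMap (show E →ₗ[ℂ] ℂ from
    F.form (F.chart.symm z.1) z.2 ∘ₗ (F.symmDeriv z.1).toLinearMap)).comp
    (ContinuousLinearMap.fst ℂ E (Fin (projDim E r) → ℂ))

theorem coordForm_apply (z u : ProjModel E r) :
    F.coordForm z u = F.form (F.chart.symm z.1) z.2 (F.symmDeriv z.1 u.1) := rfl

/-- The coframe element dual to `t_j` in the chart attached to an adapted frame. -/
noncomputable def coordCoeff (x : E) (j : Fin (projDim E r)) : Module.Dual ℂ E :=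
  F.frame.coeff (Sum.inr (some j)) (F.chart.symm x) ∘ₗ (F.symmDeriv x).toLinearMap

theorem coordCoeff_apply (x : E) (j : Fin (projDim E r)) (e : E) :
    F.coordCoeff x j e = F.frame.coeff (Sum.inr (some j)) (F.chart.symm x) (F.symmDeriv x e) := rfl

theorem differentiableAt_coordForm {z : ProjModel E r} (hz : z ∈ F.projHomeo.target) :
    DifferentiableAt ℂ F.coordForm z := by
  set S : Set (ProjModel E r) :=
    {z | z.1 ∈ F.chart.target ∧ F.chart.symm z.1 ∈ F.dom ∩ F.chart.source} with hS
  have hSo : IsOpen S := F.isOpen_coord F.chart.open_source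
  have h : ContDiffOn ℂ ω F.coordForm S := by
    rw [contDiffOn_clm_apply]
    intro u
    refine (F.contDiffOn_form F.chart.open_source (F.holVectorFieldOn_coordField u.1)).congr ?_
    intro y hy
    rw [coordForm_apply, F.coordField_symm hy.1]
  exact (h.contDiffAt (hSo.mem_nhds ⟨hz.1, hz.2, F.dom_subset hz.2⟩)).differentiableAt (by simp)

/-- The contact form is affine in the fibre coordinates, with the coframe elements τ_j as slopes. -/
theorem fderiv_coordForm_inr {z : ProjModel E r} (hz : z ∈ F.projHomeo.target)
    (b : Fin (projDim E r) → ℂ) (w : ProjModel E r) :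
    fderiv ℂ F.coordForm z (0, b) w = ∑ j, b j * F.coordCoeff z.1 j w.1 := by
  have h1 : HasFDerivAt (fun y => F.coordForm y w) ((fderiv ℂ F.coordForm z).flip w) z := by
    simpa using (F.differentiableAt_coordForm hz).hasFDerivAt.clm_apply (hasFDerivAt_const w z)
  have h2 : HasDerivAt (fun t : ℂ => F.coordForm (z + t • ((0, b) : ProjModel E r)) w)
      (fderiv ℂ F.coordForm z (0, b) w) 0 := h1.hasLineDerivAt (0, b)
  have h3 : ∀ t : ℂ, F.coordForm (z + t • ((0, b) : ProjModel E r)) w =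
      F.coordForm z w + t * ∑ j, b j * F.coordCoeff z.1 j w.1 := by
    intro t
    have : z + t • ((0, b) : ProjModel E r) = (z.1, z.2 + t • b) := by
      ext <;> simp
    rw [this, coordForm_apply, coordForm_apply]
    simp only [form, coordCoeff_apply, LinearMap.add_apply, LinearMap.sum_apply,
      LinearMap.smul_apply, Pi.add_apply, Pi.smul_apply, smul_eq_mul, add_mul, Finset.sum_add_distrib,
      Finset.mul_sum, mul_assoc, add_assoc]
  have h4 : HasDerivAt (fun t : ℂ => F.coordForm z w + t * ∑ j, b j * F.coordCoeff z.1 j w.1)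
      (∑ j, b j * F.coordCoeff z.1 j w.1) 0 := by
    simpa using ((hasDerivAt_id (0 : ℂ)).mul_const
      (∑ j, b j * F.coordCoeff z.1 j w.1)).const_add (F.coordForm z w)
  exact h2.unique (by simpa only [h3] using h4)

theorem exists_coordForm_eq_zero {z : ProjModel E r} (hz : z ∈ F.projHomeo.target)
    (b : Fin (projDim E r) → ℂ) :
    ∃ e : E, F.coordForm z (e, 0) = 0 ∧ ∀ j, F.coordCoeff z.1 j e = b j := by
  classical
  -- The vectors t_j - a_j t_0 lie in the kernel of τ_0 + Σ a_j τ_j and are dual to τ_1, ..., τ_k.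
  let w : TangentSpace 𝓘(ℂ, E) (F.chart.symm z.1) :=
    ∑ j, b j • (F.vec (Sum.inr (some j)) (F.chart.symm z.1) -
      z.2 j • F.vec (Sum.inr none) (F.chart.symm z.1))
  have hw : F.symmDeriv z.1 (F.chartDeriv z.1 w) = w := F.symmDeriv_chartDeriv hz.1 w
  refine ⟨F.chartDeriv z.1 w, ?_, fun j => ?_⟩
  · refine (congrArg (F.form (F.chart.symm z.1) z.2) hw).trans ?_
    simp [w, F.form_some hz.2, F.form_none hz.2]
  · refine (congrArg (F.frame.coeff (Sum.inr (some j)) (F.chart.symm z.1)) hw).trans ?_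
    simp [w, F.coeff_vec hz.2]

/-- Since the s_i span D, it is cut out by the coframe elements dual to t_0, ..., t_k. -/
theorem mem_fiber_iff {y : M} (hy : y ∈ F.dom) (w : TangentSpace 𝓘(ℂ, E) y) :
    w ∈ D.fiber y ↔ ∀ o, F.frame.coeff (Sum.inr o) y w = 0 := by
  constructor
  · intro hw o
    rw [← F.span_eq y hy] at hw
    have : Submodule.span ℂ (Set.range fun i => F.vec (Sum.inl i) y) ≤
        LinearMap.ker (F.frame.coeff (Sum.inr o) y) := by
      rw [Submodule.span_le]
      rintro _ ⟨i, rfl⟩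
      simp [F.coeff_vec hy]
    exact this hw
  · intro h
    have hw : w = ∑ i, F.frame.coeff i y w • F.vec i y :=
      F.frame.coeff_sum_eq (fun _ => (show E from w)) hy
    rw [hw, Fintype.sum_sum_type]
    simp only [h, zero_smul, Finset.sum_const_zero, add_zero]
    exact Submodule.sum_mem _ fun i _ => Submodule.smul_mem _ _ (F.vec_mem hy i)

theorem symmDeriv_mem_fiber_iff {z : ProjModel E r} (hz : z ∈ F.projHomeo.target) (e : E) :
    F.symmDeriv z.1 e ∈ D.fiber (F.chart.symm z.1) ↔
      F.coordForm z (e, 0) = 0 ∧ ∀ j, F.coordCoeff z.1 j e = 0 := by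
  rw [F.mem_fiber_iff hz.2, Option.forall, coordForm_apply]
  simp only [← coordCoeff_apply]
  -- Once all τ_j with j ≥ 1 vanish on the vector, τ_0 and τ_0 + Σ a_j τ_j agree on it.
  refine and_congr_left fun h => ?_
  simp only [form, LinearMap.add_apply, LinearMap.sum_apply, LinearMap.smul_apply]
  simp only [← coordCoeff_apply, h, smul_zero, Finset.sum_const_zero, add_zero]

/-- Keep a fixed and differentiate the identity η(V) = 0, which holds near the point because V is a
section of D and the normalized covectors annihilate D. -/
theorem fderiv_coordForm_add {z : ProjModel E r} (hz : z ∈ F.projHomeo.target)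
    {V : ∀ y : M, TangentSpace 𝓘(ℂ, E) y} (hV : D.IsLocalSection (F.chart.symm z.1) V) (u : E) :
    fderiv ℂ F.coordForm z (u, 0) (F.chartDeriv z.1 (V (F.chart.symm z.1)), 0) +
      F.coordForm z (fderiv ℂ (F.pullField V) z.1 u, 0) = 0 := by
  set V' : E → E := F.pullField V with hV'
  have hd : DifferentiableAt ℂ V' z.1 :=
    F.differentiableAt_pullField hz.1 hV.contMDiffAt
  have h1 : HasFDerivAt (fun x : E => ((x, z.2) : ProjModel E r))
      (ContinuousLinearMap.inl ℂ E _) z.1 := hasFDerivAt_prodMk_left z.1 z.2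
  have h2 : HasFDerivAt (fun x : E => F.coordForm (x, z.2))
      ((fderiv ℂ F.coordForm z).comp (ContinuousLinearMap.inl ℂ E _)) z.1 :=
    HasFDerivAt.comp (g := F.coordForm) z.1 (F.differentiableAt_coordForm hz).hasFDerivAt h1
  have h3 : HasFDerivAt (fun x : E => ((V' x, 0) : ProjModel E r))
      ((ContinuousLinearMap.inl ℂ E _).comp (fderiv ℂ V' z.1)) z.1 :=
    (ContinuousLinearMap.inl ℂ E (Fin (projDim E r) → ℂ)).hasFDerivAt.comp z.1 hd.hasFDerivAt
  have h4 := h2.clm_apply h3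
  have h5 : (fun x : E => F.coordForm (x, z.2) (V' x, 0)) =ᶠ[𝓝 z.1] fun _ => 0 := by
    obtain ⟨O, hO, hxO, -, hm⟩ := hV
    have hopen := F.chart.isOpen_inter_preimage_symm (F.isOpen_dom.inter hO)
    filter_upwards [hopen.mem_nhds ⟨hz.1, hz.2, hxO⟩] with x hx
    have h6 : F.symmDeriv x (V' x) = V (F.chart.symm x) := by
      rw [hV', F.pullField_apply hx.1, F.symmDeriv_chartDeriv hx.1]
    refine (congrArg (F.form (F.chart.symm x) z.2) h6).trans ?_
    exact (Submodule.mem_dualAnnihilator _).1 (F.form_mem hx.2.1 z.2) _ (hm _ hx.2.2)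
  have h7 := h4.unique ((hasFDerivAt_const (0 : ℂ) z.1).congr_of_eventuallyEq h5)
  have h8 := DFunLike.congr_fun h7 u
  have h9 : V' z.1 = F.chartDeriv z.1 (V (F.chart.symm z.1)) := F.pullField_apply hz.1 V
  rw [← h9]
  simpa [add_comm] using h8

/-- Cartan's formula for fields annihilated by the form: dη(U, V) = -η([U, V]). It is the difference
of the two differentiated identities η(V) = 0 and η(U) = 0. -/
theorem fderiv_coordForm_sub {z : ProjModel E r} (hz : z ∈ F.projHomeo.target)
    {U V : ∀ y : M, TangentSpace 𝓘(ℂ, E) y} (hU : D.IsLocalSection (F.chart.symm z.1) U)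
    (hV : D.IsLocalSection (F.chart.symm z.1) V) :
    fderiv ℂ F.coordForm z (F.chartDeriv z.1 (U (F.chart.symm z.1)), 0)
        (F.chartDeriv z.1 (V (F.chart.symm z.1)), 0) -
      fderiv ℂ F.coordForm z (F.chartDeriv z.1 (V (F.chart.symm z.1)), 0)
        (F.chartDeriv z.1 (U (F.chart.symm z.1)), 0) =
      -F.form (F.chart.symm z.1) z.2
        (VectorField.mlieBracket 𝓘(ℂ, E) U V (F.chart.symm z.1)) := by
  have e1 := F.fderiv_coordForm_add hz hV (F.chartDeriv z.1 (U (F.chart.symm z.1)))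
  have e2 := F.fderiv_coordForm_add hz hU (F.chartDeriv z.1 (V (F.chart.symm z.1)))
  have hb := F.chartDeriv_mlieBracket hz.1 hU.mdifferentiableAt hV.mdifferentiableAt
  rw [VectorField.lieBracket_eq] at hb
  have hf : F.coordForm z (F.chartDeriv z.1
      (VectorField.mlieBracket 𝓘(ℂ, E) U V (F.chart.symm z.1)), 0) =
      F.form (F.chart.symm z.1) z.2
        (VectorField.mlieBracket 𝓘(ℂ, E) U V (F.chart.symm z.1)) :=
    congrArg (F.form (F.chart.symm z.1) z.2) (F.symmDeriv_chartDeriv hz.1 _)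
  have hs : F.coordForm z (F.chartDeriv z.1
      (VectorField.mlieBracket 𝓘(ℂ, E) U V (F.chart.symm z.1)), 0) =
      F.coordForm z (fderiv ℂ (F.pullField V) z.1 (F.chartDeriv z.1 (U (F.chart.symm z.1))), 0) -
      F.coordForm z (fderiv ℂ (F.pullField U) z.1 (F.chartDeriv z.1 (V (F.chart.symm z.1))), 0) := by
    rw [← map_sub, Prod.mk_sub_mk, sub_zero, hb]
    simp only [F.pullField_apply hz.1]
  rw [← hf, hs]
  linear_combination e1 - e2

end AdaptedFrame
end HolDistribution

/-! ### Comparison of dη with the twisted differential and with the Levi form -/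

namespace HolDistribution

variable {E : Type*} [NormedAddCommGroup E] [NormedSpace ℂ E] [FiniteDimensional ℂ E]
    {M : Type*} [TopologicalSpace M] [ChartedSpace E M] [IsManifold 𝓘(ℂ, E) ω M] {r : ℕ}

namespace AdaptedFrame

variable {D : HolDistribution E M r} (F : D.AdaptedFrame)

/-- The derivative of the chart attached to an adapted frame. -/
noncomputable def projDeriv (p : D.ProjPerp) :
    TangentSpace 𝓘(ℂ, ProjModel E r) p →L[ℂ] ProjModel E r :=
  mfderiv 𝓘(ℂ, ProjModel E r) 𝓘(ℂ, ProjModel E r) F.projHomeo p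

theorem bijective_projDeriv {p : D.ProjPerp} (hp : p ∈ F.projHomeo.source) :
    Function.Bijective (F.projDeriv p) :=
  F.mdifferentiable_projHomeo.mfderiv_bijective hp

theorem mfderiv_proj_apply {p : D.ProjPerp} (hp : p ∈ F.projHomeo.source)
    (u : TangentSpace 𝓘(ℂ, ProjModel E r) p) :
    (show E from mfderiv 𝓘(ℂ, ProjModel E r) 𝓘(ℂ, E) D.proj p u) =
      F.symmDeriv (F.projHomeo p).1 (F.projDeriv p u).1 :=
  DFunLike.congr_fun (F.hasMFDerivAt_proj hp).mfderiv u

/-- The value on the normalized representative is the frame's trivialization of O(1); in it the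
contact form becomes the scalar form `coordForm`. -/
theorem contactFormRestrict_normRep {p : D.ProjPerp} (hp : p ∈ F.projHomeo.source)
    (u : TangentSpace 𝓘(ℂ, ProjModel E r) p) :
    (show Module.Dual ℂ p.line.submodule from D.contactFormRestrict p u) (F.normRep p) =
      F.coordForm (F.projHomeo p) (F.projDeriv p u) := by
  rw [contactFormRestrict_apply]
  refine (F.evalO1_normRep p _).trans ?_
  refine (F.form_projHomeo hp (fun _ => (show E from
    mfderiv 𝓘(ℂ, ProjModel E r) 𝓘(ℂ, E) D.proj p u))).symm.trans ?_
  exact congrArg (F.form (F.chart.symm (F.projHomeo p).1) (F.projHomeo p).2)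
    (F.mfderiv_proj_apply hp u)

theorem contactFormRestrict_eq_zero_iff {p : D.ProjPerp} (hp : p ∈ F.projHomeo.source)
    (u : TangentSpace 𝓘(ℂ, ProjModel E r) p) :
    D.contactFormRestrict p u = 0 ↔ F.coordForm (F.projHomeo p) (F.projDeriv p u) = 0 := by
  rw [← F.contactFormRestrict_normRep hp]
  refine ⟨fun h => ?_, fun h => F.O1_ext hp (h.trans rfl)⟩
  rw [h]
  rfl

theorem projDeriv_mfderiv_symm {z : ProjModel E r} (hz : z ∈ F.projHomeo.target)
    (u : ProjModel E r) :
    F.projDeriv (F.projHomeo.symm z)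
      (mfderiv 𝓘(ℂ, ProjModel E r) 𝓘(ℂ, ProjModel E r) F.projHomeo.symm z u) = u :=
  DFunLike.congr_fun (F.mdifferentiable_projHomeo.comp_symm_deriv hz) u

/-- The trivialization of `O(1)` attached to an adapted frame. -/
noncomputable def trivializationO1 : Bundle.Trivialization ℂ (Bundle.TotalSpace.proj (F := ℂ) (E := D.O1)) :=
  D.preO1.toFiberPrebundle.trivializationOfMemPretrivializationAtlas ⟨F, rfl⟩

instance : MemTrivializationAtlas F.trivializationO1 where
  out := ⟨F.trivO1, ⟨F, rfl⟩, rfl⟩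

theorem differentiableAt_section_normRep {p : D.ProjPerp} (hp : p ∈ F.projHomeo.source)
    {l : ∀ q : D.ProjPerp, D.O1 q}
    (hl : ContMDiffAt 𝓘(ℂ, ProjModel E r) (𝓘(ℂ, ProjModel E r).prod 𝓘(ℂ, ℂ)) ω
      (fun q => Bundle.TotalSpace.mk' ℂ q (l q)) p) :
    DifferentiableAt ℂ (fun z => (show Module.Dual ℂ (F.projHomeo.symm z).line.submodule from
      l (F.projHomeo.symm z)) (F.normRep (F.projHomeo.symm z))) (F.projHomeo p) := by
  have h1 : ContMDiffAt 𝓘(ℂ, ProjModel E r) 𝓘(ℂ, ℂ) ω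
      (fun q => (F.trivializationO1 ⟨q, l q⟩).2) p :=
    (F.trivializationO1.contMDiffAt_section_iff hp).1 hl
  have h2 : MDifferentiableAt 𝓘(ℂ, ProjModel E r) 𝓘(ℂ, ProjModel E r) F.projHomeo.symm
      (F.projHomeo p) :=
    F.mdifferentiable_projHomeo.mdifferentiableAt_symm (F.projHomeo.map_source hp)
  have h3 : MDifferentiableAt 𝓘(ℂ, ProjModel E r) 𝓘(ℂ, ℂ)
      (fun q => (F.trivializationO1 ⟨q, l q⟩).2) (F.projHomeo.symm (F.projHomeo p)) := by
    rw [F.projHomeo.left_inv hp]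
    exact h1.mdifferentiableAt (by simp)
  exact (h3.comp (F.projHomeo p) h2).differentiableAt

/-- In the chart, `coordForm` equals g times θ, where g is the value of l on the normalized
covector. On the kernel the derivative of g does not contribute, so c = g(p) works. -/
theorem exists_mul_extDerivOneForm_eq {p : D.ProjPerp} (hp : p ∈ F.projHomeo.source)
    (hc : chartAt (ProjModel E r) p = F.projHomeo) {l : ∀ q : D.ProjPerp, D.O1 q}
    {θ : ∀ q : D.ProjPerp, TangentSpace 𝓘(ℂ, ProjModel E r) q →ₗ[ℂ] ℂ}
    (h : IsLocalFactorization D.contactFormRestrict p l θ) :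
    ∃ c : ℂ, c ≠ 0 ∧ ∀ u v : TangentSpace 𝓘(ℂ, ProjModel E r) p,
      D.contactFormRestrict p u = 0 → D.contactFormRestrict p v = 0 →
      c * extDerivOneForm θ p u v =
        fderiv ℂ F.coordForm (F.projHomeo p) (F.projDeriv p u) (F.projDeriv p v) -
        fderiv ℂ F.coordForm (F.projHomeo p) (F.projDeriv p v) (F.projDeriv p u) := by
  obtain ⟨O, hO, hpO, hl, hlp, hϑ⟩ := h
  set g : ProjModel E r → ℂ := fun z =>
    (show Module.Dual ℂ (F.projHomeo.symm z).line.submodule from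
      l (F.projHomeo.symm z)) (F.normRep (F.projHomeo.symm z)) with hg
  set η : ProjModel E r → ProjModel E r →L[ℂ] ℂ := fun z =>
    LinearMap.toContinuousLinearMap (show ProjModel E r →ₗ[ℂ] ℂ from
      (θ (F.projHomeo.symm z)) ∘ₗ
        (mfderiv 𝓘(ℂ, ProjModel E r) 𝓘(ℂ, ProjModel E r) F.projHomeo.symm z).toLinearMap) with hη
  have hz := F.projHomeo.map_source hp
  have hgd : DifferentiableAt ℂ g (F.projHomeo p) :=
    F.differentiableAt_section_normRep hp (hl.contMDiffAt (hO.mem_nhds hpO))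
  have hg0 : g (F.projHomeo p) ≠ 0 := by
    have key : ∀ q, q = p → (show Module.Dual ℂ q.line.submodule from l q) (F.normRep q) ≠ 0 := by
      rintro q rfl h0
      exact hlp (F.O1_ext hp (h0.trans rfl))
    exact key _ (F.projHomeo.left_inv hp)
  -- Evaluate ϑ = θ ⊗ l on the normalized covector, at every point of the chart near p.
  have hev : ∀ᶠ z in 𝓝 (F.projHomeo p), F.coordForm z = g z • η z := by
    have hsymm : ContinuousAt F.projHomeo.symm (F.projHomeo p) := F.projHomeo.continuousAt_symm hz
    have hOn : O ∈ 𝓝 (F.projHomeo.symm (F.projHomeo p)) := by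
      rw [F.projHomeo.left_inv hp]
      exact hO.mem_nhds hpO
    filter_upwards [F.projHomeo.open_target.mem_nhds hz, hsymm hOn] with z hzt hzO
    refine ContinuousLinearMap.ext fun u => ?_
    set w := mfderiv 𝓘(ℂ, ProjModel E r) 𝓘(ℂ, ProjModel E r) F.projHomeo.symm z u with hw
    have h1 := F.contactFormRestrict_normRep (F.projHomeo.map_target hzt) w
    rw [hw, F.projDeriv_mfderiv_symm hzt, F.projHomeo.right_inv hzt, ← hw] at h1
    have h2 := hϑ _ hzO w
    rw [← h1, h2]
    exact mul_comm _ _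
  have hηd : DifferentiableAt ℂ η (F.projHomeo p) :=
    differentiableAt_of_smul hgd hg0 (F.differentiableAt_coordForm hz) hev
  have hker : ∀ u : TangentSpace 𝓘(ℂ, ProjModel E r) p, D.contactFormRestrict p u = 0 →
      η (F.projHomeo p) (F.projDeriv p u) = 0 := by
    intro u hu
    have h1 := (F.contactFormRestrict_eq_zero_iff hp u).1 hu
    rw [hev.self_of_nhds] at h1
    exact (mul_eq_zero.1 h1).resolve_left hg0
  refine ⟨g (F.projHomeo p), hg0, fun u v hu hv => ?_⟩
  rw [fderiv_smul_apply_of_apply_eq_zero hgd hηd hev (hker u hu),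
    fderiv_smul_apply_of_apply_eq_zero hgd hηd hev (hker v hv), ← mul_sub,
    ← extDeriv_ofSubsingleton_apply hηd, extDerivOneForm_apply]
  have : oneFormInChart θ p = fun z =>
      ContinuousAlternatingMap.ofSubsingleton ℂ (ProjModel E r) ℂ (0 : Fin 1) (η z) := by
    funext z
    -- The preferred chart enters dependent types, so it is generalized before being replaced by the
    -- chart of F.
    have key : ∀ e : OpenPartialHomeomorph D.ProjPerp (ProjModel E r), e = F.projHomeo →
        ContinuousAlternatingMap.ofSubsingleton ℂ (ProjModel E r) ℂ (0 : Fin 1)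
          (LinearMap.toContinuousLinearMap (show ProjModel E r →ₗ[ℂ] ℂ from (θ (e.symm z)) ∘ₗ
            (mfderiv 𝓘(ℂ, ProjModel E r) 𝓘(ℂ, ProjModel E r) e.symm z).toLinearMap)) =
        ContinuousAlternatingMap.ofSubsingleton ℂ (ProjModel E r) ℂ (0 : Fin 1) (η z) := by
      rintro _ rfl
      rfl
    exact key _ hc
  rw [this, hc]
  rfl

/-- The part of the exterior derivative of the contact form along the directions of `M`. -/
noncomputable def coordBracket (z : ProjModel E r) : E →ₗ[ℂ] E →ₗ[ℂ] ℂ :=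
  LinearMap.mk₂ ℂ (fun e e' => fderiv ℂ F.coordForm z (e, 0) (e', 0) -
      fderiv ℂ F.coordForm z (e', 0) (e, 0))
    (by
      intro a b e
      have : ((a + b, 0) : ProjModel E r) = (a, 0) + (b, 0) := by simp
      rw [this, map_add, map_add, add_apply]
      ring)
    (by
      intro c a e
      have : ((c • a, 0) : ProjModel E r) = c • (a, 0) := by simp
      rw [this, map_smul, map_smul, smul_apply, smul_sub])
    (by
      intro e a b
      have : ((a + b, 0) : ProjModel E r) = (a, 0) + (b, 0) := by simp
      rw [this, map_add, map_add, add_apply]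
      ring)
    (by
      intro c e a
      have : ((c • a, 0) : ProjModel E r) = c • (a, 0) := by simp
      rw [this, map_smul, map_smul, smul_apply, smul_sub])

theorem coordBracket_apply (z : ProjModel E r) (e e' : E) :
    F.coordBracket z e e' = fderiv ℂ F.coordForm z (e, 0) (e', 0) -
      fderiv ℂ F.coordForm z (e', 0) (e, 0) := rfl

theorem coordBracket_swap (z : ProjModel E r) (e e' : E) :
    F.coordBracket z e' e = -F.coordBracket z e e' := by
  rw [coordBracket_apply, coordBracket_apply, neg_sub]

theorem coordForm_eq_fst (z u : ProjModel E r) : F.coordForm z u = F.coordForm z (u.1, 0) := rfl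

theorem fderiv_coordForm_apply_fst {z : ProjModel E r} (hz : z ∈ F.projHomeo.target)
    (u w : ProjModel E r) :
    fderiv ℂ F.coordForm z u w = fderiv ℂ F.coordForm z u (w.1, 0) := by
  have h : ∀ w : ProjModel E r, fderiv ℂ (fun y => F.coordForm y w) z u =
      fderiv ℂ F.coordForm z u w := fun w => by
    rw [fderiv_clm_apply (F.differentiableAt_coordForm hz) (differentiableAt_const w)]
    simp
  rw [← h w, ← h (w.1, 0)]
  simp only [F.coordForm_eq_fst _ w]

/-- Split each vector into its M-direction and its fibre direction. There is no fibre-fibre term,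
since the form ignores fibre components. -/
theorem fderiv_coordForm_sub_eq {z : ProjModel E r} (hz : z ∈ F.projHomeo.target)
    (w v : ProjModel E r) :
    fderiv ℂ F.coordForm z w v - fderiv ℂ F.coordForm z v w =
      ∑ j, w.2 j * F.coordCoeff z.1 j v.1 - ∑ j, v.2 j * F.coordCoeff z.1 j w.1 +
        F.coordBracket z w.1 v.1 := by
  have h : ∀ w v : ProjModel E r, fderiv ℂ F.coordForm z w v =
      fderiv ℂ F.coordForm z (w.1, 0) (v.1, 0) + ∑ j, w.2 j * F.coordCoeff z.1 j v.1 := by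
    intro w v
    have hw : w = (w.1, 0) + (0, w.2) := by simp
    conv_lhs => rw [hw]
    rw [map_add, add_apply, F.fderiv_coordForm_inr hz,
      F.fderiv_coordForm_apply_fst hz]
  rw [h w v, h v w, coordBracket_apply]
  ring

theorem mem_fiber_base_iff {p : D.ProjPerp} (hp : p ∈ F.projHomeo.source) (e : E) :
    (show TangentSpace 𝓘(ℂ, E) p.base from (F.symmDeriv (F.projHomeo p).1 e : E)) ∈
        D.fiber p.base ↔
      F.coordForm (F.projHomeo p) (e, 0) = 0 ∧ ∀ j, F.coordCoeff (F.projHomeo p).1 j e = 0 := by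
  rw [← F.symmDeriv_mem_fiber_iff (F.projHomeo.map_source hp)]
  have key : ∀ y : M, y = p.base → ∀ w : E, ((show TangentSpace 𝓘(ℂ, E) p.base from w) ∈
      D.fiber p.base ↔ (show TangentSpace 𝓘(ℂ, E) y from w) ∈ D.fiber y) := by
    rintro y rfl w
    rfl
  exact key _ (F.chart_symm_projHomeo_fst hp) _

/-- Extend v and w to local sections of D and apply Cartan's formula. The normalized covector and α
differ by a nonzero scalar, so only the vanishing is compared. -/
theorem coordBracket_eq_zero_iff {x : M} (α : D.perp x) (hα : α ≠ 0)
    (hp : D.projPoint α hα ∈ F.projHomeo.source) (v w : D.fiber x) {e e' : E}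
    (he : (F.symmDeriv (F.projHomeo (D.projPoint α hα)).1 e : E) =
      (show E from (v : TangentSpace 𝓘(ℂ, E) x)))
    (he' : (F.symmDeriv (F.projHomeo (D.projPoint α hα)).1 e' : E) =
      (show E from (w : TangentSpace 𝓘(ℂ, E) x))) :
    F.coordBracket (F.projHomeo (D.projPoint α hα)) e e' = 0 ↔ D.perpLevi x α v w = 0 := by
  set z := F.projHomeo (D.projPoint α hα) with hzd
  have hz : z ∈ F.projHomeo.target := F.projHomeo.map_source hp
  have hb : F.chart.symm z.1 = x := F.chart_symm_projHomeo_fst hp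
  have hval : ∀ (v : D.fiber x) (e : E), (F.symmDeriv z.1 e : E) =
      (show E from (v : TangentSpace 𝓘(ℂ, E) x)) →
      F.chartDeriv z.1 (D.localSection x v (F.chart.symm z.1)) = e := by
    intro v e he
    have key : ∀ y : M, y = x → (show E from D.localSection x v y) =
        (show E from (v : TangentSpace 𝓘(ℂ, E) x)) := by
      rintro y rfl
      exact (D.localSection_spec _ v).2
    have h1 : D.localSection x v (F.chart.symm z.1) = F.symmDeriv z.1 e :=
      (key _ hb).trans he.symm
    rw [h1]
    exact F.chartDeriv_symmDeriv hz.1 e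
  have hs : ∀ v : D.fiber x, D.IsLocalSection (F.chart.symm z.1) (D.localSection x v) := by
    intro v
    rw [hb]
    exact (D.localSection_spec x v).1
  have h1 := F.fderiv_coordForm_sub hz (hs v) (hs w)
  rw [hval v e he, hval w e' he', ← coordBracket_apply] at h1
  have h2 := F.form_projHomeo hp
    (VectorField.mlieBracket 𝓘(ℂ, E) (D.localSection x v) (D.localSection x w))
  obtain ⟨c, hc, hrep⟩ := ProjPerp.exists_rep_projPoint α hα
  -- By definition the Levi tensor is the class of the bracket of precisely these chosen local
  -- sections.
  have h3 : (D.projPoint α hα).line.rep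
      (VectorField.mlieBracket 𝓘(ℂ, E) (D.localSection x v) (D.localSection x w) x) =
      c * D.perpLevi x α v w := LinearMap.congr_fun hrep _
  rw [h1, h2, neg_eq_zero, div_eq_zero_iff, or_iff_left hp.2]
  refine (Eq.congr_left h3).trans ?_
  rw [mul_eq_zero, or_iff_right hc]

end AdaptedFrame
end HolDistribution

/-! ### The null spaces and the isomorphism between them -/

section

variable {G : Type*} [NormedAddCommGroup G] [NormedSpace ℂ G] [FiniteDimensional ℂ G]
    {Y : Type*} [TopologicalSpace Y] [ChartedSpace G Y]
    {L : Y → Type*} [∀ y, AddCommGroup (L y)] [∀ y, Module ℂ (L y)]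
    [∀ y, TopologicalSpace (L y)] [TopologicalSpace (Bundle.TotalSpace ℂ L)] [FiberBundle ℂ L]
    [VectorBundle ℂ ℂ L] [ContMDiffVectorBundle ω ℂ L 𝓘(ℂ, G)]

theorem exists_twistedDifferential_eq_zero_iff
    (ϑ : ∀ q : Y, TangentSpace 𝓘(ℂ, G) q →ₗ[ℂ] L q) (p : Y) :
    ∃ l θ, IsLocalFactorization ϑ p l θ ∧ ∀ u v : LinearMap.ker (ϑ p),
      twistedDifferential ϑ p u v = 0 ↔ extDerivOneForm θ p u v = 0 := by
  have h := (exists_isLocalFactorization ϑ p).choose_spec.choose_spec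
  refine ⟨_, _, h, fun u v => ?_⟩
  obtain ⟨O, -, -, -, hl, -⟩ := h
  exact smul_eq_zero.trans (or_iff_left hl)

end

namespace HolDistribution

variable {E : Type*} [NormedAddCommGroup E] [NormedSpace ℂ E] [FiniteDimensional ℂ E]
    {M : Type*} [TopologicalSpace M] [ChartedSpace E M] [IsManifold 𝓘(ℂ, E) ω M] {r : ℕ}
    {D : HolDistribution E M r}

/-- The chart derivative at p is bijective and carries the kernel of ϑ to the pairs (e, b) with η(e)
= 0 and b arbitrary, so the null condition becomes the linear-algebra condition of the lemmas on
null spaces. -/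
theorem AdaptedFrame.mem_nullTwistedDifferential_iff (F : D.AdaptedFrame) {p : D.ProjPerp}
    (hp : p ∈ F.projHomeo.source) (hc : chartAt (ProjModel E r) p = F.projHomeo)
    (v : LinearMap.ker (D.contactFormRestrict p)) :
    v ∈ nullTwistedDifferential D.contactFormRestrict p ↔
      ∀ (e : E) (b : Fin (projDim E r) → ℂ), F.coordForm (F.projHomeo p) (e, 0) = 0 →
        ∑ j, b j * F.coordCoeff (F.projHomeo p).1 j (F.projDeriv p v).1 -
          ∑ j, (F.projDeriv p v).2 j * F.coordCoeff (F.projHomeo p).1 j e +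
            F.coordBracket (F.projHomeo p) e (F.projDeriv p v).1 = 0 := by
  obtain ⟨l, θ, hfac, hiff⟩ := exists_twistedDifferential_eq_zero_iff D.contactFormRestrict p
  obtain ⟨c, hc0, hd⟩ := F.exists_mul_extDerivOneForm_eq hp hc hfac
  have hz := F.projHomeo.map_source hp
  have key : ∀ u : LinearMap.ker (D.contactFormRestrict p),
      twistedDifferential D.contactFormRestrict p u v = 0 ↔
      ∑ j, (F.projDeriv p u).2 j * F.coordCoeff (F.projHomeo p).1 j (F.projDeriv p v).1 -
          ∑ j, (F.projDeriv p v).2 j * F.coordCoeff (F.projHomeo p).1 j (F.projDeriv p u).1 +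
            F.coordBracket (F.projHomeo p) (F.projDeriv p u).1 (F.projDeriv p v).1 = 0 := by
    intro u
    rw [hiff, ← F.fderiv_coordForm_sub_eq hz, ← hd u v u.2 v.2, mul_eq_zero, or_iff_right hc0]
  constructor
  · intro h e b he
    obtain ⟨u, hu⟩ := (F.bijective_projDeriv hp).2 (e, b)
    have hk : D.contactFormRestrict p u = 0 := by
      rw [F.contactFormRestrict_eq_zero_iff hp, hu]
      exact he
    have := (key ⟨u, hk⟩).1 (h ⟨u, hk⟩)
    simpa only [hu] using this
  · intro h u
    refine (key u).2 (h _ _ ?_)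
    exact (F.contactFormRestrict_eq_zero_iff hp u).1 u.2

theorem AdaptedFrame.mfderiv_proj_mem_fiber_iff (F : D.AdaptedFrame) {p : D.ProjPerp}
    (hp : p ∈ F.projHomeo.source) (u : TangentSpace 𝓘(ℂ, ProjModel E r) p) :
    mfderiv 𝓘(ℂ, ProjModel E r) 𝓘(ℂ, E) D.proj p u ∈ D.fiber p.base ↔
      F.coordForm (F.projHomeo p) ((F.projDeriv p u).1, 0) = 0 ∧
        ∀ j, F.coordCoeff (F.projHomeo p).1 j (F.projDeriv p u).1 = 0 := by
  rw [← F.mem_fiber_base_iff hp, ← F.mfderiv_proj_apply hp]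
  rfl

theorem mfderiv_proj_mem_fiber {p : D.ProjPerp} {v : LinearMap.ker (D.contactFormRestrict p)}
    (hv : v ∈ nullTwistedDifferential D.contactFormRestrict p) :
    mfderiv 𝓘(ℂ, ProjModel E r) 𝓘(ℂ, E) D.proj p v ∈ D.fiber p.base := by
  obtain ⟨F, hp, hc⟩ := AdaptedFrame.exists_chartAt_eq p
  rw [F.mfderiv_proj_mem_fiber_iff hp]
  exact ⟨(F.contactFormRestrict_eq_zero_iff hp v).1 v.2,
    apply_eq_zero_of_forall_null (l := (F.coordForm (F.projHomeo p)).toLinearMap ∘ₗ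
      LinearMap.inl ℂ E _) ((F.mem_nullTwistedDifferential_iff hp hc v).1 hv)⟩

/-- The null vector sits in the second slot of the twisted differential but in the first slot of the
Levi form; antisymmetry reconciles the two. -/
theorem AdaptedFrame.coordBracket_swap_eq_zero_iff (F : D.AdaptedFrame) {x : M} (α : D.perp x)
    (hα : α ≠ 0) (hp : D.projPoint α hα ∈ F.projHomeo.source) (v w : D.fiber x) {e e' : E}
    (he : (F.symmDeriv (F.projHomeo (D.projPoint α hα)).1 e : E) =
      (show E from (v : TangentSpace 𝓘(ℂ, E) x)))
    (he' : (F.symmDeriv (F.projHomeo (D.projPoint α hα)).1 e' : E) =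
      (show E from (w : TangentSpace 𝓘(ℂ, E) x))) :
    F.coordBracket (F.projHomeo (D.projPoint α hα)) e' e = 0 ↔ D.perpLevi x α v w = 0 := by
  rw [F.coordBracket_swap, neg_eq_zero, F.coordBracket_eq_zero_iff α hα hp v w he he']

theorem mem_nullPerpLevi_of_mem_nullTwistedDifferential {x : M} (α : D.perp x) (hα : α ≠ 0)
    {v : LinearMap.ker (D.contactFormRestrict (D.projPoint α hα))}
    (hv : v ∈ nullTwistedDifferential D.contactFormRestrict (D.projPoint α hα)) :
    (⟨mfderiv 𝓘(ℂ, ProjModel E r) 𝓘(ℂ, E) D.proj (D.projPoint α hα) v,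
      mfderiv_proj_mem_fiber hv⟩ : D.fiber x) ∈ D.nullPerpLevi x α := by
  obtain ⟨F, hp, hc⟩ := AdaptedFrame.exists_chartAt_eq (D.projPoint α hα)
  have hz := F.projHomeo.map_source hp
  intro w
  set e : E := F.chartDeriv (F.projHomeo (D.projPoint α hα)).1
    (show E from (w : TangentSpace 𝓘(ℂ, E) x)) with he
  have hew : (F.symmDeriv (F.projHomeo (D.projPoint α hα)).1 e : E) =
      (show E from (w : TangentSpace 𝓘(ℂ, E) x)) := F.symmDeriv_chartDeriv hz.1 _
  have hef := (F.mem_fiber_base_iff hp e).1 (by rw [hew]; exact w.2)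
  refine (F.coordBracket_swap_eq_zero_iff α hα hp _ w
    (F.mfderiv_proj_apply hp v).symm hew).1 ?_
  -- Test against (e, 0) with e in D: both sums vanish, and only the bracket term is left.
  simpa [hef.2] using (F.mem_nullTwistedDifferential_iff hp hc v).1 hv e 0 hef.1

/-- The differential of `ℙ D^⊥ → M` as a map between the null spaces of the twisted differential
of the contact form and of the Levi tensor. -/
noncomputable def nullProj {x : M} (α : D.perp x) (hα : α ≠ 0) :
    nullTwistedDifferential D.contactFormRestrict (D.projPoint α hα) →ₗ[ℂ] D.nullPerpLevi x α :=
  LinearMap.codRestrict _ (LinearMap.codRestrict (D.fiber x)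
    ((mfderiv 𝓘(ℂ, ProjModel E r) 𝓘(ℂ, E) D.proj (D.projPoint α hα)).toLinearMap ∘ₗ
      (LinearMap.ker (D.contactFormRestrict (D.projPoint α hα))).subtype ∘ₗ Submodule.subtype _)
    fun v => mfderiv_proj_mem_fiber v.2)
    fun v => mem_nullPerpLevi_of_mem_nullTwistedDifferential α hα v.2

theorem coe_nullProj {x : M} (α : D.perp x) (hα : α ≠ 0)
    (v : nullTwistedDifferential D.contactFormRestrict (D.projPoint α hα)) :
    ((nullProj α hα v : D.fiber x) : TangentSpace 𝓘(ℂ, E) x) =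
      mfderiv 𝓘(ℂ, ProjModel E r) 𝓘(ℂ, E) D.proj (D.projPoint α hα)
        ((v : LinearMap.ker (D.contactFormRestrict (D.projPoint α hα))) :
          TangentSpace 𝓘(ℂ, ProjModel E r) (D.projPoint α hα)) := rfl

theorem bijective_nullProj {x : M} (α : D.perp x) (hα : α ≠ 0) :
    Function.Bijective (nullProj α hα) := by
  obtain ⟨F, hp, hc⟩ := AdaptedFrame.exists_chartAt_eq (D.projPoint α hα)
  set z := F.projHomeo (D.projPoint α hα) with hzd
  have hz : z ∈ F.projHomeo.target := F.projHomeo.map_source hp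
  have hs : ∀ b : Fin (projDim E r) → ℂ, ∃ e : E,
      ((F.coordForm z).toLinearMap ∘ₗ LinearMap.inl ℂ E _) e = 0 ∧
        ∀ j, F.coordCoeff z.1 j e = b j := F.exists_coordForm_eq_zero hz
  constructor
  · rw [injective_iff_map_eq_zero]
    intro v hv
    have h0 : mfderiv 𝓘(ℂ, ProjModel E r) 𝓘(ℂ, E) D.proj (D.projPoint α hα)
        ((v : LinearMap.ker (D.contactFormRestrict (D.projPoint α hα))) :
          TangentSpace 𝓘(ℂ, ProjModel E r) (D.projPoint α hα)) = 0 := by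
      rw [← coe_nullProj, hv]
      rfl
    have h1 : F.symmDeriv z.1 (F.projDeriv (D.projPoint α hα) v).1 = 0 :=
      (F.mfderiv_proj_apply hp _).symm.trans h0
    have h2 : (F.projDeriv (D.projPoint α hα) v).1 = 0 := by
      have h := F.chartDeriv_symmDeriv hz.1 (F.projDeriv (D.projPoint α hα) v).1
      rw [h1, map_zero] at h
      exact h.symm
    have h3 := (F.mem_nullTwistedDifferential_iff hp hc v).1 v.2
    rw [h2] at h3
    -- A null vector with zero projection has only fibre components, and independence of the τ_j on
    -- the kernel of η removes these.
    have h4 : (F.projDeriv (D.projPoint α hα) v).2 = 0 := eq_zero_of_forall_null hs h3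
    have h5 : F.projDeriv (D.projPoint α hα) v = 0 := Prod.ext h2 h4
    exact Subtype.ext (Subtype.ext
      ((F.bijective_projDeriv hp).1 (h5.trans (map_zero (F.projDeriv _)).symm)))
  · intro w
    set e : E := F.chartDeriv z.1 (show E from ((w : D.fiber x) : TangentSpace 𝓘(ℂ, E) x)) with he
    have hew : (F.symmDeriv z.1 e : E) =
        (show E from ((w : D.fiber x) : TangentSpace 𝓘(ℂ, E) x)) := F.symmDeriv_chartDeriv hz.1 _
    have hef := (F.mem_fiber_base_iff hp e).1 (by rw [hew]; exact w.1.2)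
    -- The vector a is the fibre component that corrects the horizontal lift of w to a null vector.
    -- The hypothesis on B holds because e' lies in D and w is null for the Levi form.
    obtain ⟨a, ha⟩ := exists_forall_null (B := F.coordBracket z) hs hef.2 (by
      intro e' h1 h2
      exact (F.coordBracket_swap_eq_zero_iff α hα hp w
        ⟨_, (F.mem_fiber_base_iff hp e').2 ⟨h1, h2⟩⟩ hew rfl).2 (w.2 _))
    obtain ⟨u, hu⟩ := (F.bijective_projDeriv hp).2 (e, a)
    have hk : D.contactFormRestrict (D.projPoint α hα) u = 0 := by
      rw [F.contactFormRestrict_eq_zero_iff hp, hu]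
      exact hef.1
    have hn : (⟨u, hk⟩ : LinearMap.ker (D.contactFormRestrict (D.projPoint α hα))) ∈
        nullTwistedDifferential D.contactFormRestrict (D.projPoint α hα) := by
      rw [F.mem_nullTwistedDifferential_iff hp hc]
      simp only [hu]
      exact ha
    refine ⟨⟨⟨u, hk⟩, hn⟩, Subtype.ext (Subtype.ext ?_)⟩
    refine (F.mfderiv_proj_apply hp u).trans ?_
    rw [hu]
    exact hew

end HolDistribution

theorem proposition3p6 {E : Type*} [NormedAddCommGroup E] [NormedSpace ℂ E]
    [FiniteDimensional ℂ E] {M : Type*} [TopologicalSpace M] [ChartedSpace E M]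
    [IsManifold 𝓘(ℂ, E) ω M] {r : ℕ} (D : HolDistribution E M r) (x : M)
    (α : D.perp x) (hα : α ≠ 0) :
    ∃ e : nullTwistedDifferential D.contactFormRestrict (D.projPoint α hα) ≃ₗ[ℂ]
        D.nullPerpLevi x α,
      ∀ v : nullTwistedDifferential D.contactFormRestrict (D.projPoint α hα),
        ((e v : D.fiber x) : TangentSpace 𝓘(ℂ, E) x) =
          mfderiv 𝓘(ℂ, HolDistribution.ProjModel E r) 𝓘(ℂ, E) D.proj (D.projPoint α hα)
            ((v : LinearMap.ker (D.contactFormRestrict (D.projPoint α hα))) :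
              TangentSpace 𝓘(ℂ, HolDistribution.ProjModel E r) (D.projPoint α hα)) :=
  ⟨LinearEquiv.ofBijective (HolDistribution.nullProj α hα) (HolDistribution.bijective_nullProj α hα),
    HolDistribution.coe_nullProj α hα⟩
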